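/- Let $\lambda>0$ and $\delta>0$ satisfy $(1-\lambda)e^{2\delta}<1$. Then there is a constant $K>0$, depending only on $\lambda$ and $\delta$, such that the following holds for every fractional Black--Scholes model, that is, for all $H\in(0,1)$, $\mu\in\mathbb R$, $\sigma>0$, $T\in(0,\infty)$, every filtered probability space $(\Omega,\mathcal F,(\mathcal F_t)_{0\le t\le T},P)$ satisfying the usual conditions, every standard fractional Brownian motion $B^H=(B^H_t)_{0\le t\le T}$ with Hurst parameter $H$ on it (continuous, centred, Gaussian, with $E[B^H_sB^H_t]=\tfrac12(s^{2H}+t^{2H}-|t-s|^{2H})$), adapted price process $S_t=\exp(\mu t+\sigma B^H_t)$, and all $x>0$. Trading strategies are adapted càdlàg finite variation processes $\varphi=(\varphi^0_t,\varphi^1_t)$ indexed by $\{0_-\}\cup[0,T]$. Write $\varphi^1=\varphi^1_{0_-}+\varphi^{1,\uparrow}-\varphi^{1,\downarrow}$ for the Jordan--Hahn decomposition. Let $\mathcal C(x)$ be the set of all terminal values $V^{liq}_T(\varphi)$, where $V^{liq}_t(\varphi)=\varphi^0_t+(\varphi^1_t)^+(1-\lambda)S_t-(\varphi^1_t)^-S_t$,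 of strategies $\varphi$ with $(\varphi^0_{0_-},\varphi^1_{0_-})=(x,0)$ that are self-financing, i.e. $\int_s^t d\varphi^0_u\le-\int_s^tS_u\,d\varphi^{1,\uparrow}_u+\int_s^t(1-\lambda)S_u\,d\varphi^{1,\downarrow}_u$ for $0_-\le s\le t\le T$, and admissible, i.e. $V^{liq}_t(\varphi)\ge0$ for $0\le t\le T$ (all relations between random variables and processes hold almost surely). Let $X=\log S$, let $\sigma_0=0$, $\sigma_{j+1}=\inf\{t\in[\sigma_j,T]: |X_t-X_{\sigma_j}|\ge\delta\}$ (with $\inf\emptyset=\infty$), and let $\overline F=\sup\{j\ge0:\sigma_j\le T\}$ be the number of $\delta$-fluctuations of $X$ up to time $T$. (i) For every $g\in\mathcal C(x)$, almost surely, for every $n\in\mathbb N_0$: $g\le xK^n$ on $\{\overline F=n\}$. (ii) For every concave $U:(0,\infty)\to\mathbb R\cup\{-\infty\}$, extended to $0$ by its right limit there, and every $g\in\mathcal C(x)$ one has $E[U(g)^+]<\infty$, and the set $\{E[U(g)]: g\in\mathcal C(x)\}$ is bounded from above by a real number. Hence $u(x)=\sup_{g\in\mathcal C(x)}E[U(g)]<\infty$.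 Moreover, $u(x)>-\infty$ if $U(x)>-\infty$; in particular, $u(x)$ is finite if $U$ is real-valued. -/

import Mathlib

open MeasureTheory ProbabilityTheory Set Filter Topology
open scoped NNReal ENNReal

noncomputable section

/-! ### Fractional Brownian motion and the fractional Black-Scholes model -/

/-- `B = (B_t)_{0 ≤ t ≤ T}` is a standard fractional Brownian motion with Hurst parameter `H` under
`P`: a centred Gaussian process with almost surely continuous paths and covariance
`E[B_s B_t] = (s^{2H} + t^{2H} - |t - s|^{2H}) / 2`. -/
structure IsFractionalBrownianMotion {Ω : Type*} {m : MeasurableSpace Ω} {T : ℝ≥0}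
    (H : ℝ) (B : Iic T → Ω → ℝ) (P : Measure Ω) : Prop where
  gaussian : IsGaussianProcess B P
  centered : ∀ t, ∫ ω, B t ω ∂P = 0
  covariance_eq : ∀ s t : Iic T,
    covariance (B s) (B t) P =
      (((s : ℝ≥0) : ℝ) ^ (2 * H) + ((t : ℝ≥0) : ℝ) ^ (2 * H)
        - |((t : ℝ≥0) : ℝ) - ((s : ℝ≥0) : ℝ)| ^ (2 * H)) / 2
  continuous_paths : ∀ᵐ ω ∂P, Continuous fun t => B t ω

/-- The price process `S_t = exp (μ t + σ B_t)`, `0 ≤ t ≤ T`. -/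
def fbsPrice {Ω : Type*} {T : ℝ≥0} (μ σ : ℝ) (B : Iic T → Ω → ℝ) : Iic T → Ω → ℝ :=
  fun t ω => Real.exp (μ * ((t : ℝ≥0) : ℝ) + σ * B t ω)

/-- The usual conditions of right-continuity and completeness. -/
structure UsualConditions {Ω : Type*} {m : MeasurableSpace Ω} {T : ℝ≥0}
    (𝓕 : Filtration (Iic T) m) (P : Measure Ω) : Prop where
  rightContinuous : 𝓕.IsRightContinuous
  complete : ∀ (t : Iic T) (N : Set Ω), P N = 0 → MeasurableSet[𝓕 t] N

/-! ### Fluctuations of a path -/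

/-- The `δ`-fluctuation times of a path `X` on `[0, T]`: `σ_0 = 0` and
`σ_{j+1} = inf {t ≥ σ_j : |X_t - X_{σ_j}| ≥ δ}`, with `inf ∅ = ∞` (and `σ_{j+1} = ∞` as soon as
`σ_j = ∞`). -/
def fluctuationTime {T : ℝ≥0} (δ : ℝ) (X : Iic T → ℝ) : ℕ → ℝ≥0∞
  | 0 => 0
  | j + 1 => sInf {r : ℝ≥0∞ | ∃ s t : Iic T,
      ((s : ℝ≥0) : ℝ≥0∞) = fluctuationTime δ X j ∧ s ≤ t ∧ δ ≤ |X t - X s| ∧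
        r = ((t : ℝ≥0) : ℝ≥0∞)}

/-- The number of `δ`-fluctuations up to time `T`: `sup {j ≥ 0 : σ_j ≤ T}`. -/
def fluctuationCount {T : ℝ≥0} (δ : ℝ) (X : Iic T → ℝ) : ℕ∞ :=
  ⨆ (j : ℕ) (_ : fluctuationTime δ X j ≤ (T : ℝ≥0∞)), (j : ℕ∞)

/-! ### Trading with proportional transaction costs -/

/-- The projection of the real line onto `[0, T]`. -/
def clampTime (T : ℝ≥0) (t : ℝ) : Iic T := ⟨min t.toNNReal T, mem_Iic.2 (min_le_right _ _)⟩

/-- A path indexed by `[0₋, T] = {0₋} ∪ [0, T]`, with value `a` at `0₋` and `f t` at `t ∈ [0, T]`,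
seen as a function on the real line: the value at `0₋` is taken at all negative times, the value at
`T` at all times after `T`. -/
def embedPath {T : ℝ≥0} (a : ℝ) (f : Iic T → ℝ) : ℝ → ℝ :=
  fun t => if t < 0 then a else f (clampTime T t)

/-- Right-continuity with left limits. -/
def IsCadlagPath {T : ℝ≥0} (f : Iic T → ℝ) : Prop :=
  (∀ t, ContinuousWithinAt f (Ici t) t) ∧ ∀ t, ∃ l : ℝ, Tendsto f (𝓝[<] t) (𝓝 l)

/-- The liquidation value `b + h⁺ (1 - λ) s - h⁻ s` of `b` bonds and `h` shares at price `s`. -/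
def liquidationValue (lam s b h : ℝ) : ℝ := b + max h 0 * ((1 - lam) * s) - max (-h) 0 * s

/-- The pathwise self-financing condition
`∫_s^t dφ⁰ ≤ - ∫_s^t S dφ^{1,↑} + ∫_s^t (1 - λ) S dφ^{1,↓}`, `0₋ ≤ s ≤ t ≤ T`, for holdings `f0`,
`f1` of finite variation with the values `x0`, `x1` at `0₋`. The integrals are over `(s, t]`, and
`dφ^{1,↑}`, `dφ^{1,↓}` are the positive and the negative part in the Jordan decomposition of the
Stieltjes measure `dφ¹`; a negative `s` or `t` stands for `0₋`. -/
def IsSelfFinancingPath {T : ℝ≥0} (lam : ℝ) (S : Iic T → ℝ) (x0 x1 : ℝ) (f0 f1 : Iic T → ℝ) :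
    Prop :=
  ∃ h : BoundedVariationOn (embedPath x1 f1) univ, ∀ s t : ℝ, s ≤ t → t ≤ T →
    embedPath x0 f0 t - embedPath x0 f0 s ≤
      - (∫ u in Ioc s t, S (clampTime T u) ∂(SignedMeasure.toJordanDecomposition h.vectorMeasure).posPart)
      + ∫ u in Ioc s t, (1 - lam) * S (clampTime T u)
          ∂(SignedMeasure.toJordanDecomposition h.vectorMeasure).negPart

/-- `φ = (φ⁰, φ¹)` is a self-financing and admissible trading strategy under proportional
transaction costs `λ` with initial endowment `(φ⁰_{0₋}, φ¹_{0₋}) = (x, 0)`: both components are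
adapted, càdlàg and of finite variation, and the liquidation value is nonnegative on `[0, T]`. -/
structure IsAdmissibleStrategy {Ω : Type*} {m : MeasurableSpace Ω} {T : ℝ≥0}
    (P : Measure Ω) (𝓕 : Filtration (Iic T) m) (S : Iic T → Ω → ℝ) (lam x : ℝ)
    (φ0 φ1 : Iic T → Ω → ℝ) : Prop where
  adapted_bond : Adapted 𝓕 φ0
  adapted_stock : Adapted 𝓕 φ1
  cadlag_bond : ∀ᵐ ω ∂P, IsCadlagPath fun t => φ0 t ω
  cadlag_stock : ∀ᵐ ω ∂P, IsCadlagPath fun t => φ1 t ω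
  finiteVariation_bond : ∀ᵐ ω ∂P, BoundedVariationOn (embedPath x fun t => φ0 t ω) univ
  finiteVariation_stock : ∀ᵐ ω ∂P, BoundedVariationOn (embedPath 0 fun t => φ1 t ω) univ
  selfFinancing : ∀ᵐ ω ∂P, IsSelfFinancingPath lam (fun t => S t ω) x 0
    (fun t => φ0 t ω) (fun t => φ1 t ω)
  admissible : ∀ᵐ ω ∂P, ∀ t, 0 ≤ liquidationValue lam (S t ω) (φ0 t ω) (φ1 t ω)

/-- The set `C(x)` of terminal liquidation values (up to almost sure equality) of the self-financing
and admissible strategies with initial endowment `(x, 0)`. -/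
def terminalWealths {Ω : Type*} {m : MeasurableSpace Ω} {T : ℝ≥0}
    (P : Measure Ω) (𝓕 : Filtration (Iic T) m) (S : Iic T → Ω → ℝ) (lam x : ℝ) : Set (Ω → ℝ) :=
  {g | ∃ φ0 φ1 : Iic T → Ω → ℝ, IsAdmissibleStrategy P 𝓕 S lam x φ0 φ1 ∧
    ∀ᵐ ω ∂P, g ω = liquidationValue lam (S ⟨T, self_mem_Iic⟩ ω) (φ0 ⟨T, self_mem_Iic⟩ ω)
      (φ1 ⟨T, self_mem_Iic⟩ ω)}

/-! ### Expected utility -/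

/-- `U` restricted to `(0, ∞)` is a concave function with values in `ℝ ∪ {-∞}`. -/
def IsConcaveUtility (U : ℝ → EReal) : Prop :=
  (∀ y, 0 < y → U y ≠ ⊤) ∧
  ∀ y z a b : ℝ, 0 < y → 0 < z → 0 < a → 0 < b → a + b = 1 →
    (a : EReal) * U y + (b : EReal) * U z ≤ U (a * y + b * z)

/-- The utility of a wealth `y ≥ 0`: `U y` for `y > 0`, and the limit of `U` from the right at `0`
for `y = 0` (a concave `U` has such a limit in `[-∞, ∞)`, which `limsup` computes). -/
def utilityOf (U : ℝ → EReal) (y : ℝ) : EReal :=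
  if 0 < y then U y else limsup U (𝓝[>] (0 : ℝ))

/-- `E[U(g)⁺]`. -/
def expectedUtilityPos {Ω : Type*} {m : MeasurableSpace Ω} (P : Measure Ω) (U : ℝ → EReal)
    (g : Ω → ℝ) : ℝ≥0∞ :=
  ∫⁻ ω, (utilityOf U (g ω)).toENNReal ∂P

/-- `E[U(g)⁻]`. -/
def expectedUtilityNeg {Ω : Type*} {m : MeasurableSpace Ω} (P : Measure Ω) (U : ℝ → EReal)
    (g : Ω → ℝ) : ℝ≥0∞ :=
  ∫⁻ ω, (-utilityOf U (g ω)).toENNReal ∂P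

/-- `E[U(g)] = E[U(g)⁺] - E[U(g)⁻]`, an extended real number (`-∞` if both parts are infinite). -/
def expectedUtility {Ω : Type*} {m : MeasurableSpace Ω} (P : Measure Ω) (U : ℝ → EReal)
    (g : Ω → ℝ) : EReal :=
  (expectedUtilityPos P U g : EReal) - (expectedUtilityNeg P U g : EReal)

/-- The indirect utility `u(x) = sup {E[U(g)] : g ∈ C(x)}`. -/
def indirectUtility {Ω : Type*} {m : MeasurableSpace Ω} {T : ℝ≥0}
    (P : Measure Ω) (𝓕 : Filtration (Iic T) m) (S : Iic T → Ω → ℝ) (lam : ℝ) (U : ℝ → EReal)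
    (x : ℝ) : EReal :=
  ⨆ g ∈ terminalWealths P 𝓕 S lam x, expectedUtility P U g

end

/-! ### Paths indexed by `[0₋, T]` -/

/-! The wealth bound is pathwise. During one `δ`-fluctuation that starts at price `a`, the bid stays
below `max (1 - λ) 0 * e^δ * a` and the ask above `e^(-δ) * a`. The hypothesis `(1 - λ) e^(2δ) < 1`
says precisely that a gap remains between the two, so one constant price lies strictly inside the
spread throughout. Valued at that price, a self-financing portfolio cannot gain
(`IsSelfFinancingPath.value_antitone`). At the next fluctuation the price is replaced by a new one;
solvency bounds the number of shares held, so the revaluation costs at most the factor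
`growthFactor`, which is `K`. Iterating gives `x * K ^ n`
(`liquidationValue_le_of_fluctuationCount_eq`).

It remains to show that the fluctuation count `F` has all exponential moments. If `F ≥ n`, the log
price has absolute increments summing to at least `n * δ` along some `n + 1` times. For fixed times
this is a maximum of `2 ^ n` signed Gaussian sums. Covariances of disjoint increments all have the
same sign, so these variances are at most of order `n ^ (1 - ν)`, `ν = min (2H) 1`, and the tail is
`exp (-c n ^ (1 + ν))`. This beats every `exp (-L n)`, and also the union bound over times in a
dyadic grid of level about `n ^ (ν / 2)`; chaining controls the rounding to the grid
(`eventually_measure_le_fluctuationCount`).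

Finally, a concave utility lies below an affine function, so `E[U(g)⁺]` is bounded through the
series `∑ K ^ n * P (F ≥ n)`, uniformly in `g`. Not trading at all gives the lower bound. -/

lemma continuous_clampTime (T : ℝ≥0) : Continuous (clampTime T) :=
  Continuous.subtype_mk (continuous_real_toNNReal.min continuous_const) _

lemma monotone_clampTime (T : ℝ≥0) : Monotone (clampTime T) := fun _ _ h =>
  Subtype.mk_le_mk.2 (min_le_min_right _ (Real.toNNReal_mono h))

@[simp]
lemma clampTime_coe {T : ℝ≥0} (t : Iic T) : clampTime T ((t : ℝ≥0) : ℝ) = t := by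
  ext
  simp [clampTime, mem_Iic.1 t.2]

lemma coe_clampTime {T : ℝ≥0} {t : ℝ} (h0 : 0 ≤ t) (hT : t ≤ T) :
    ((clampTime T t : ℝ≥0) : ℝ) = t := by
  simp [clampTime, h0, hT]

@[simp]
lemma embedPath_coe {T : ℝ≥0} (a : ℝ) (f : Iic T → ℝ) (t : Iic T) :
    embedPath a f ((t : ℝ≥0) : ℝ) = f t := by
  simp [embedPath]

lemma embedPath_of_neg {T : ℝ≥0} (a : ℝ) (f : Iic T → ℝ) {t : ℝ} (ht : t < 0) :
    embedPath a f t = a := if_pos ht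

/-- The Stieltjes measure of `(s, t]` is a difference of right limits; for càdlàg holdings these are
the values themselves, including at `0`, where an initial jump may occur. -/
lemma IsCadlagPath.rightLim_embedPath {T : ℝ≥0} {f : Iic T → ℝ} (hf : IsCadlagPath f) (a t : ℝ) :
    (embedPath a f).rightLim t = embedPath a f t := by
  refine ContinuousWithinAt.rightLim_eq ?_
  rcases lt_or_ge t 0 with ht | ht
  · refine ContinuousAt.continuousWithinAt ?_
    refine (continuousAt_const (y := a)).congr ?_
    filter_upwards [Iio_mem_nhds ht] with u hu
    exact (embedPath_of_neg a f hu).symm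
  · have h : ContinuousWithinAt (fun u => f (clampTime T u)) (Ici t) t :=
      (hf.1 (clampTime T t)).comp (continuous_clampTime T).continuousWithinAt
        (fun u hu => monotone_clampTime T hu)
    refine h.congr (fun u hu => ?_) ?_
    · exact if_neg (not_lt.2 (ht.trans hu))
    · exact if_neg (not_lt.2 ht)

lemma measureReal_jordan_sub {f : ℝ → ℝ} (h : BoundedVariationOn f univ)
    {s t : ℝ} (hst : s ≤ t) :
    (SignedMeasure.toJordanDecomposition h.vectorMeasure).posPart.real (Ioc s t) -
      (SignedMeasure.toJordanDecomposition h.vectorMeasure).negPart.real (Ioc s t) =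
      f.rightLim t - f.rightLim s := by
  have h1 := h.vectorMeasure_Ioc hst
  rw [← SignedMeasure.toSignedMeasure_toJordanDecomposition h.vectorMeasure,
    JordanDecomposition.toSignedMeasure, Measure.toSignedMeasure_sub_apply measurableSet_Ioc] at h1
  exact h1

/-- If a constant price lies in the bid-ask spread throughout `(s, t]`, then the value of a
self-financing portfolio at this price does not increase. -/
lemma IsSelfFinancingPath.value_antitone {T : ℝ≥0} {lam x0 x1 : ℝ} {S f0 f1 : Iic T → ℝ}
    (h : IsSelfFinancingPath lam S x0 x1 f0 f1) (hS : Continuous S) (hf1 : IsCadlagPath f1)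
    {s t p : ℝ} (hst : s ≤ t) (htT : t ≤ T)
    (hp : ∀ u ∈ Ioc s t, (1 - lam) * S (clampTime T u) ≤ p ∧ p ≤ S (clampTime T u)) :
    embedPath x0 f0 t + p * embedPath x1 f1 t ≤ embedPath x0 f0 s + p * embedPath x1 f1 s := by
  obtain ⟨hbv, hsf⟩ := h
  have key := hsf s t hst htT
  have hj := measureReal_jordan_sub hbv hst
  rw [hf1.rightLim_embedPath, hf1.rightLim_embedPath] at hj
  set J := SignedMeasure.toJordanDecomposition hbv.vectorMeasure
  have hcont : Continuous fun u => S (clampTime T u) := hS.comp (continuous_clampTime T)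
  have hint : ∀ ν : Measure ℝ, IsFiniteMeasure ν →
      IntegrableOn (fun u => S (clampTime T u)) (Ioc s t) ν := fun ν _ =>
    (hcont.continuousOn.integrableOn_compact isCompact_Icc).mono_set Ioc_subset_Icc_self
  -- Every purchase costs at least `p` per share, and below every sale earns at most `p`.
  have hpos : p * J.posPart.real (Ioc s t) ≤ ∫ u in Ioc s t, S (clampTime T u) ∂J.posPart := by
    have := setIntegral_mono_on (μ := J.posPart) (f := fun _ => p)
      (integrableOn_const (by finiteness)) (hint J.posPart inferInstance)
      measurableSet_Ioc (fun u hu => (hp u hu).2)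
    simpa [mul_comm] using this
  have hneg : ∫ u in Ioc s t, (1 - lam) * S (clampTime T u) ∂J.negPart
      ≤ p * J.negPart.real (Ioc s t) := by
    have := setIntegral_mono_on (μ := J.negPart) (g := fun _ => p)
      ((hint J.negPart inferInstance).const_mul (1 - lam)) (integrableOn_const (by finiteness))
      measurableSet_Ioc (fun u hu => (hp u hu).1)
    simpa [mul_comm] using this
  have : p * (embedPath x1 f1 t - embedPath x1 f1 s) =
      p * J.posPart.real (Ioc s t) - p * J.negPart.real (Ioc s t) := by rw [← hj]; ring
  linarith

lemma isSelfFinancingPath_const {T : ℝ≥0} (lam x : ℝ) (S : Iic T → ℝ) :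
    IsSelfFinancingPath lam S x 0 (fun _ => x) (fun _ => 0) := by
  have h0 : embedPath (T := T) 0 (fun _ => 0) = fun _ => 0 := by
    ext t; simp [embedPath]
  have hx : embedPath (T := T) x (fun _ => x) = fun _ => x := by
    ext t; simp [embedPath]
  have hbv : BoundedVariationOn (embedPath (T := T) 0 (fun _ => 0)) univ := by
    have h1 := eVariationOn.constant_on (f := fun _ : ℝ => (0 : ℝ)) (s := univ)
      (by simp [Set.Subsingleton])
    rw [h0, BoundedVariationOn, h1]
    exact ENNReal.zero_ne_top
  have hcad : IsCadlagPath (T := T) (fun _ => (0 : ℝ)) :=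
    ⟨fun _ => continuousWithinAt_const, fun _ => ⟨0, tendsto_const_nhds⟩⟩
  have hJ : SignedMeasure.toJordanDecomposition hbv.vectorMeasure = 0 := by
    -- All increments vanish, so both parts agree on every `(a, b]` and hence everywhere; their
    -- difference is then the zero measure.
    have hparts : (SignedMeasure.toJordanDecomposition hbv.vectorMeasure).posPart =
        (SignedMeasure.toJordanDecomposition hbv.vectorMeasure).negPart := by
      refine Measure.ext_of_Ioc _ _ fun a b hab => ?_
      have := measureReal_jordan_sub hbv hab.le
      rw [hcad.rightLim_embedPath, hcad.rightLim_embedPath, congrFun h0 a, congrFun h0 b,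
        sub_self, sub_eq_zero] at this
      exact (measureReal_eq_measureReal_iff (by finiteness) (by finiteness)).1 this
    have hzero : hbv.vectorMeasure = 0 := by
      rw [← SignedMeasure.toSignedMeasure_toJordanDecomposition hbv.vectorMeasure,
        JordanDecomposition.toSignedMeasure]
      ext i hi
      rw [Measure.toSignedMeasure_sub_apply hi, hparts]
      simp
    rw [hzero]
    exact SignedMeasure.toJordanDecomposition_zero
  refine ⟨hbv, fun s t _ _ => ?_⟩
  rw [hJ, hx]
  simp

/-! ### Fluctuation times of continuous paths -/

lemma fluctuationTime_succ_le {T : ℝ≥0} {δ : ℝ} {X : Iic T → ℝ} {j : ℕ} {s t : Iic T}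
    (hs : ((s : ℝ≥0) : ℝ≥0∞) = fluctuationTime δ X j) (hst : s ≤ t) (h : δ ≤ |X t - X s|) :
    fluctuationTime δ X (j + 1) ≤ ((t : ℝ≥0) : ℝ≥0∞) :=
  sInf_le ⟨s, t, hs, hst, h, rfl⟩

/-- The infimum is attained: by continuity the candidate times form a closed subset of the compact
`[0, T]`. -/
lemma exists_of_fluctuationTime_succ_ne_top {T : ℝ≥0} {δ : ℝ} {X : Iic T → ℝ} (hX : Continuous X)
    {j : ℕ} (h : fluctuationTime δ X (j + 1) ≠ ⊤) :
    ∃ s t : Iic T, ((s : ℝ≥0) : ℝ≥0∞) = fluctuationTime δ X j ∧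
      ((t : ℝ≥0) : ℝ≥0∞) = fluctuationTime δ X (j + 1) ∧ s ≤ t ∧ δ ≤ |X t - X s| := by
  have hne : {r : ℝ≥0∞ | ∃ s t : Iic T, ((s : ℝ≥0) : ℝ≥0∞) = fluctuationTime δ X j ∧ s ≤ t ∧
      δ ≤ |X t - X s| ∧ r = ((t : ℝ≥0) : ℝ≥0∞)}.Nonempty := by
    by_contra hempty
    rw [Set.not_nonempty_iff_eq_empty] at hempty
    exact h (by rw [fluctuationTime, hempty, sInf_empty])
  obtain ⟨_, s, t0, hs, hst0, ht0, -⟩ := hne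
  have hcl : IsClosed {t : Iic T | s ≤ t ∧ δ ≤ |X t - X s|} :=
    isClosed_Ici.inter
      (isClosed_le continuous_const (hX.sub continuous_const).abs)
  have : CompactSpace (Iic T) := by
    rw [← isCompact_iff_compactSpace, ← Icc_bot]; exact isCompact_Icc
  obtain ⟨t, ⟨hst, ht⟩, hmin⟩ := hcl.isCompact.exists_isLeast ⟨t0, hst0, ht0⟩
  refine ⟨s, t, hs, le_antisymm ?_ (fluctuationTime_succ_le hs hst ht), hst, ht⟩
  refine le_sInf ?_
  rintro _ ⟨s', t', hs', hst', ht', rfl⟩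
  have : s' = s := by
    have := hs'.trans hs.symm
    exact Subtype.ext (by exact_mod_cast this)
  subst this
  have h2 : t ≤ t' := hmin ⟨hst', ht'⟩
  exact_mod_cast h2

lemma exists_coe_eq_fluctuationTime {T : ℝ≥0} {δ : ℝ} {X : Iic T → ℝ} (hX : Continuous X)
    {j : ℕ} (h : fluctuationTime δ X j ≠ ⊤) :
    ∃ t : Iic T, ((t : ℝ≥0) : ℝ≥0∞) = fluctuationTime δ X j := by
  cases j with
  | zero => exact ⟨⟨0, mem_Iic.2 zero_le⟩, by simp [fluctuationTime]⟩
  | succ j =>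
    obtain ⟨_, t, -, ht, -⟩ := exists_of_fluctuationTime_succ_ne_top hX h
    exact ⟨t, ht⟩

lemma fluctuationTime_ne_top_of_le {T : ℝ≥0} {δ : ℝ} {X : Iic T → ℝ} (hX : Continuous X)
    {i j : ℕ} (hij : i ≤ j) (h : fluctuationTime δ X j ≠ ⊤) : fluctuationTime δ X i ≠ ⊤ := by
  induction j, hij using Nat.le_induction with
  | base => exact h
  | succ j _ ih =>
    obtain ⟨s, _, hs, -⟩ := exists_of_fluctuationTime_succ_ne_top hX h
    exact ih (by rw [← hs]; exact ENNReal.coe_ne_top)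

lemma fluctuationTime_ne_top_of_le_count {T : ℝ≥0} {δ : ℝ} {X : Iic T → ℝ} (hX : Continuous X)
    {n : ℕ} (h : (n : ℕ∞) ≤ fluctuationCount δ X) : fluctuationTime δ X n ≠ ⊤ := by
  rcases n with _ | n
  · simp [fluctuationTime]
  intro htop
  have : fluctuationCount δ X ≤ n := by
    refine iSup₂_le fun j hj => ?_
    have hjn : j ≤ n := by
      by_contra! hlt
      exact fluctuationTime_ne_top_of_le hX (i := n + 1) (j := j) hlt
        (hj.trans_lt ENNReal.coe_lt_top).ne htop
    exact_mod_cast hjn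
  have := h.trans this
  have : n + 1 ≤ n := by exact_mod_cast this
  omega

lemma fluctuationTime_eq_top_of_count_lt {T : ℝ≥0} {δ : ℝ} {X : Iic T → ℝ} (hX : Continuous X)
    {n : ℕ} (h : fluctuationCount δ X < n) : fluctuationTime δ X n = ⊤ := by
  by_contra hne
  obtain ⟨t, ht⟩ := exists_coe_eq_fluctuationTime hX hne
  refine h.not_ge (le_iSup₂_of_le (f := fun (j : ℕ) (_ : fluctuationTime δ X j ≤ (T : ℝ≥0∞)) =>
    (j : ℕ∞)) n ?_ le_rfl)
  rw [← ht]
  exact_mod_cast t.2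

/-- A continuous path with at least `n` fluctuations moves by at least `δ` between `n + 1`
successive times. -/
lemma exists_times_of_le_fluctuationCount {T : ℝ≥0} {δ : ℝ} {X : Iic T → ℝ} (hX : Continuous X)
    {n : ℕ} (h : (n : ℕ∞) ≤ fluctuationCount δ X) :
    ∃ τ : Fin (n + 1) → Iic T, Monotone τ ∧ ∀ i : Fin n, δ ≤ |X (τ i.succ) - X (τ i.castSucc)| := by
  have hn := fluctuationTime_ne_top_of_le_count hX h
  have hex : ∀ i : Fin (n + 1), ∃ t : Iic T, ((t : ℝ≥0) : ℝ≥0∞) = fluctuationTime δ X i :=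
    fun i => exists_coe_eq_fluctuationTime hX
      (fluctuationTime_ne_top_of_le hX (Nat.lt_succ_iff.1 i.2) hn)
  choose τ hτ using hex
  have hstep : ∀ i : Fin n, τ i.castSucc ≤ τ i.succ ∧
      δ ≤ |X (τ i.succ) - X (τ i.castSucc)| := by
    intro i
    obtain ⟨s, t, hs, ht, hst, hd⟩ := exists_of_fluctuationTime_succ_ne_top hX (j := i)
      (fluctuationTime_ne_top_of_le hX i.2 hn)
    have h1 : τ i.castSucc = s := by
      have := (hτ i.castSucc).trans (by simpa using hs.symm)
      exact Subtype.ext (by exact_mod_cast this)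
    have h2 : τ i.succ = t := by
      have := (hτ i.succ).trans (by simpa using ht.symm)
      exact Subtype.ext (by exact_mod_cast this)
    rw [h1, h2]
    exact ⟨hst, hd⟩
  exact ⟨τ, Fin.monotone_iff_le_succ.2 fun i => (hstep i).1, fun i => (hstep i).2⟩

/-! ### The pathwise wealth bound -/

lemma liquidationValue_le {lam s b h p : ℝ} (h1 : (1 - lam) * s ≤ p) (h2 : p ≤ s) :
    liquidationValue lam s b h ≤ b + p * h := by
  unfold liquidationValue
  rcases le_total 0 h with hh | hh
  · rw [max_eq_left hh, max_eq_right (by linarith)]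
    nlinarith
  · rw [max_eq_right hh, max_eq_left (by linarith)]
    nlinarith

/-- A solvent portfolio holds few shares compared to its value at a price well inside the
bid-ask spread. -/
lemma abs_mul_le_of_liquidationValue_nonneg {lam s b h p ε : ℝ}
    (h1 : (1 - lam) * s ≤ p - ε) (h2 : p + ε ≤ s) (hL : 0 ≤ liquidationValue lam s b h) :
    |h| * ε ≤ b + p * h := by
  unfold liquidationValue at hL
  rcases le_total 0 h with hh | hh
  · rw [max_eq_left hh, max_eq_right (by linarith)] at hL
    rw [abs_of_nonneg hh]
    nlinarith
  · rw [max_eq_right hh, max_eq_left (by linarith)] at hL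
    rw [abs_of_nonpos hh]
    nlinarith

/-- Revaluation from `p` to `p'` changes the value by `(p' - p) * h`, and solvency controls `|h| *
ε` by the value at `p`. -/
lemma value_le_mul_of_liquidationValue_nonneg {lam s b h p p' ε D : ℝ} (hε : 0 < ε)
    (h1 : (1 - lam) * s ≤ p - ε) (h2 : p + ε ≤ s) (hL : 0 ≤ liquidationValue lam s b h)
    (hD : |p' - p| ≤ D * ε) : b + p' * h ≤ (b + p * h) * (1 + D) := by
  have h3 := abs_mul_le_of_liquidationValue_nonneg h1 h2 hL
  have h4 : (p' - p) * h ≤ D * ε * |h| := by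
    calc (p' - p) * h ≤ |(p' - p) * h| := le_abs_self _
      _ = |p' - p| * |h| := abs_mul _ _
      _ ≤ _ := by gcongr
  have hD0 : 0 ≤ D := by
    have := (abs_nonneg _).trans hD
    exact nonneg_of_mul_nonneg_left this hε
  nlinarith [mul_le_mul_of_nonneg_left h3 hD0]

lemma exp_neg_mul_le_and_le_exp_mul {a b δ : ℝ} (ha : 0 < a) (hb : 0 < b)
    (h : |Real.log b - Real.log a| ≤ δ) : Real.exp (-δ) * a ≤ b ∧ b ≤ Real.exp δ * a := by
  rw [abs_le] at h
  have hea := Real.exp_log ha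
  have heb := Real.exp_log hb
  constructor
  · calc Real.exp (-δ) * a = Real.exp (-δ + Real.log a) := by rw [Real.exp_add, hea]
      _ ≤ Real.exp (Real.log b) := Real.exp_le_exp.2 (by linarith)
      _ = b := heb
  · calc b = Real.exp (Real.log b) := heb.symm
      _ ≤ Real.exp (δ + Real.log a) := Real.exp_le_exp.2 (by linarith)
      _ = _ := by rw [Real.exp_add, hea]

/-- The centre of the interval of constant prices, relative to the price at the start of a
fluctuation, that stay in the bid-ask spread throughout the fluctuation. -/
noncomputable def spreadCenter (lam δ : ℝ) : ℝ :=
  (Real.exp (-δ) + max (1 - lam) 0 * Real.exp δ) / 2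

/-- Half the length of that interval. -/
noncomputable def spreadRadius (lam δ : ℝ) : ℝ :=
  (Real.exp (-δ) - max (1 - lam) 0 * Real.exp δ) / 2

/-- The factor by which wealth can grow during one fluctuation. -/
noncomputable def growthFactor (lam δ : ℝ) : ℝ :=
  1 + spreadCenter lam δ * Real.exp δ / spreadRadius lam δ

lemma spreadCenter_pos (lam δ : ℝ) : 0 < spreadCenter lam δ := by
  unfold spreadCenter; positivity

/-- This is where the relation between transaction costs and fluctuation size enters. -/
lemma spreadRadius_pos {lam δ : ℝ} (h : (1 - lam) * Real.exp (2 * δ) < 1) :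
    0 < spreadRadius lam δ := by
  unfold spreadRadius
  have h1 : max (1 - lam) 0 * Real.exp (2 * δ) < 1 := by
    rcases le_total (1 - lam) 0 with h0 | h0
    · rw [max_eq_right h0]; simp
    · rwa [max_eq_left h0]
  have h2 : max (1 - lam) 0 * Real.exp δ =
      max (1 - lam) 0 * Real.exp (2 * δ) * Real.exp (-δ) := by
    rw [mul_assoc, ← Real.exp_add]; congr 2; ring
  have := Real.exp_pos (-δ)
  rw [h2]
  nlinarith

lemma one_le_growthFactor {lam δ : ℝ} (h : (1 - lam) * Real.exp (2 * δ) < 1) :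
    1 ≤ growthFactor lam δ := by
  have h1 := spreadCenter_pos lam δ
  have h2 := spreadRadius_pos h
  have : 0 ≤ spreadCenter lam δ * Real.exp δ / spreadRadius lam δ := by positivity
  unfold growthFactor
  linarith

lemma bid_le_sub_and_add_le_ask {lam δ a b : ℝ} (ha : 0 < a) (hb : 0 < b)
    (h : |Real.log b - Real.log a| ≤ δ) :
    (1 - lam) * b ≤ spreadCenter lam δ * a - spreadRadius lam δ * a ∧
      spreadCenter lam δ * a + spreadRadius lam δ * a ≤ b := by
  obtain ⟨h1, h2⟩ := exp_neg_mul_le_and_le_exp_mul ha hb h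
  constructor
  -- For `lam > 1` the upper bound on `b` would give the wrong direction; truncating `1 - lam` at
  -- `0` avoids this.
  · calc (1 - lam) * b ≤ max (1 - lam) 0 * b := by gcongr; exact le_max_left _ _
      _ ≤ max (1 - lam) 0 * (Real.exp δ * a) := by gcongr
      _ = _ := by unfold spreadCenter spreadRadius; ring
  · calc _ = Real.exp (-δ) * a := by unfold spreadCenter spreadRadius; ring
      _ ≤ b := h1

lemma abs_sub_le_exp_mul {a b δ : ℝ} (ha : 0 < a) (hb : 0 < b) (hδ : 0 ≤ δ)
    (h : |Real.log b - Real.log a| ≤ δ) : |b - a| ≤ Real.exp δ * a := by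
  obtain ⟨h1, h2⟩ := exp_neg_mul_le_and_le_exp_mul ha hb h
  have h3 : 1 ≤ Real.exp δ := Real.one_le_exp hδ
  have h4 : 0 < Real.exp (-δ) := Real.exp_pos _
  rw [abs_le]
  constructor <;> nlinarith

section Wealth

variable {T : ℝ≥0} {lam δ x : ℝ} {S f0 f1 : Iic T → ℝ}

lemma abs_log_sub_lt_of_lt_fluctuationTime {X : Iic T → ℝ} {j : ℕ} {s u : Iic T}
    (hs : ((s : ℝ≥0) : ℝ≥0∞) = fluctuationTime δ X j) (hsu : s ≤ u)
    (hu : ((u : ℝ≥0) : ℝ≥0∞) < fluctuationTime δ X (j + 1)) : |X u - X s| < δ := by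
  by_contra! hge
  exact hu.not_ge (fluctuationTime_succ_le hs hsu hge)

/-- Before the next fluctuation time the bound is strict; at that time itself it survives by
continuity, as `u` is a limit of earlier times. -/
lemma abs_log_sub_le_of_le_fluctuationTime {X : Iic T → ℝ} (hX : Continuous X) (hδ : 0 < δ)
    {j : ℕ} {s u : Iic T}
    (hs : ((s : ℝ≥0) : ℝ≥0∞) = fluctuationTime δ X j) (hsu : s ≤ u)
    (hu : ((u : ℝ≥0) : ℝ≥0∞) ≤ fluctuationTime δ X (j + 1)) : |X u - X s| ≤ δ := by
  rcases hsu.eq_or_lt with rfl | hlt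
  · simpa using hδ.le
  have hmem : u ∈ closure (Ioo s u) := by
    have hlt' : ((s : ℝ≥0) : ℝ) < ((u : ℝ≥0) : ℝ) := by exact_mod_cast hlt
    have h1 : ((u : ℝ≥0) : ℝ) ∈ closure (Ioo ((s : ℝ≥0) : ℝ) ((u : ℝ≥0) : ℝ)) := by
      rw [closure_Ioo hlt'.ne]; exact ⟨hlt'.le, le_rfl⟩
    have h2 := image_closure_subset_closure_image (continuous_clampTime T)
      (mem_image_of_mem _ h1)
    rw [clampTime_coe] at h2
    refine closure_mono ?_ h2
    rintro _ ⟨r, ⟨hr1, hr2⟩, rfl⟩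
    have hr : ((clampTime T r : ℝ≥0) : ℝ) = r :=
      coe_clampTime ((NNReal.coe_nonneg _).trans hr1.le)
        (hr2.le.trans (by exact_mod_cast u.2))
    constructor
    · change ((s : ℝ≥0)) < ((clampTime T r : ℝ≥0))
      rw [← NNReal.coe_lt_coe, hr]; exact hr1
    · change ((clampTime T r : ℝ≥0)) < ((u : ℝ≥0))
      rw [← NNReal.coe_lt_coe, hr]; exact hr2
  have hcl : IsClosed {v : Iic T | |X v - X s| ≤ δ} := isClosed_le (by fun_prop) continuous_const
  refine hcl.closure_subset_iff.2 ?_ hmem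
  intro v hv
  refine (abs_log_sub_lt_of_lt_fluctuationTime hs hv.1.le (lt_of_lt_of_le ?_ hu)).le
  exact_mod_cast hv.2

lemma value_le_of_abs_log_le (hS : Continuous S) (hpos : ∀ t, 0 < S t)
    (hlam : (1 - lam) * Real.exp (2 * δ) < 1) (hf1 : IsCadlagPath f1)
    (hsf : IsSelfFinancingPath lam S x 0 f0 f1) {s t : Iic T} (hst : s ≤ t)
    (h : ∀ u, s ≤ u → u ≤ t → |Real.log (S u) - Real.log (S s)| ≤ δ) :
    f0 t + spreadCenter lam δ * S s * f1 t ≤ f0 s + spreadCenter lam δ * S s * f1 s := by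
  have := hsf.value_antitone hS hf1 (s := (s : ℝ≥0)) (t := (t : ℝ≥0))
    (p := spreadCenter lam δ * S s) (by exact_mod_cast hst) (by exact_mod_cast t.2) ?_
  · simpa using this
  intro u hu
  have h1 : s ≤ clampTime T u := by
    rw [← clampTime_coe s]; exact monotone_clampTime T hu.1.le
  have h2 : clampTime T u ≤ t := by
    rw [← clampTime_coe t]; exact monotone_clampTime T hu.2
  obtain ⟨h3, h4⟩ := bid_le_sub_and_add_le_ask (lam := lam) (hpos s) (hpos _) (h _ h1 h2)
  have h5 : 0 < spreadRadius lam δ * S s := mul_pos (spreadRadius_pos hlam) (hpos s)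
  constructor <;> linarith

/-- Induction over the fluctuations: between two of them the value at the constant price of the
earlier one cannot rise, and passing to the next constant price costs one factor `growthFactor`. -/
lemma value_at_fluctuationTime_le (hS : Continuous S) (hpos : ∀ t, 0 < S t) (hδ : 0 < δ)
    (hlam : (1 - lam) * Real.exp (2 * δ) < 1)
    (hf1 : IsCadlagPath f1) (hsf : IsSelfFinancingPath lam S x 0 f0 f1)
    (hadm : ∀ t, 0 ≤ liquidationValue lam (S t) (f0 t) (f1 t)) (j : ℕ) (s : Iic T)
    (hs : ((s : ℝ≥0) : ℝ≥0∞) = fluctuationTime δ (fun t => Real.log (S t)) j) :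
    f0 s + spreadCenter lam δ * S s * f1 s ≤ x * growthFactor lam δ ^ j := by
  have hX : Continuous fun t => Real.log (S t) := hS.log fun t => (hpos t).ne'
  have hr := spreadRadius_pos hlam
  induction j generalizing s with
  | zero =>
    have hs0 : ((s : ℝ≥0) : ℝ) = 0 := by
      have : (s : ℝ≥0) = 0 := by simpa [fluctuationTime] using hs
      simp [this]
    -- Time `-1` stands for `0₋`, so that trades at time `0` are included.
    have := hsf.value_antitone hS hf1 (s := -1) (t := 0) (p := spreadCenter lam δ * S s)
      (by norm_num) (NNReal.coe_nonneg _) ?_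
    · have h1 : (-1 : ℝ) < 0 := by norm_num
      have e0 := embedPath_coe x f0 s
      have e1 := embedPath_coe 0 f1 s
      rw [hs0] at e0 e1
      rw [embedPath_of_neg _ _ h1, embedPath_of_neg _ _ h1, e0, e1] at this
      simpa using this
    intro u hu
    have hus : clampTime T u = s := by
      have h1 : u.toNNReal = 0 := Real.toNNReal_of_nonpos hu.2
      have h2 : (s : ℝ≥0) = 0 := by exact_mod_cast hs0
      ext
      simp [clampTime, h1, h2]
    rw [hus]
    obtain ⟨h3, h4⟩ := bid_le_sub_and_add_le_ask (lam := lam) (δ := δ) (hpos s) (hpos s)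
      (by simpa using hδ.le)
    have h5 : 0 < spreadRadius lam δ * S s := mul_pos hr (hpos s)
    constructor <;> linarith
  | succ j ih =>
    obtain ⟨r, t, hr', ht, hrt, -⟩ := exists_of_fluctuationTime_succ_ne_top hX (j := j)
      (by rw [← hs]; exact ENNReal.coe_ne_top)
    have hts : t = s := Subtype.ext (by exact_mod_cast ht.trans hs.symm)
    subst hts
    have hosc : ∀ u, r ≤ u → u ≤ t → |Real.log (S u) - Real.log (S r)| ≤ δ := by
      intro u hru hut
      refine abs_log_sub_le_of_le_fluctuationTime (X := fun t => Real.log (S t)) hX hδ hr' hru ?_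
      rw [← hs]
      exact_mod_cast hut
    have h1 := value_le_of_abs_log_le hS hpos hlam hf1 hsf hrt hosc
    obtain ⟨h3, h4⟩ := bid_le_sub_and_add_le_ask (lam := lam) (hpos r) (hpos t)
      (hosc t hrt le_rfl)
    have hc := spreadCenter_pos lam δ
    -- Here `D` is the price move, at most `spreadCenter * e^δ * S r`, in units of the distance
    -- `spreadRadius * S r` to the edges of the spread.
    have h2 := value_le_mul_of_liquidationValue_nonneg (p' := spreadCenter lam δ * S t)
      (D := spreadCenter lam δ * Real.exp δ / spreadRadius lam δ)
      (mul_pos hr (hpos r)) h3 h4 (hadm t) (by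
        rw [← mul_sub, abs_mul, abs_of_pos hc]
        calc _ ≤ spreadCenter lam δ * (Real.exp δ * S r) := by
              gcongr
              exact abs_sub_le_exp_mul (hpos r) (hpos t) hδ.le (hosc t hrt le_rfl)
          _ = _ := by field_simp)
    calc _ ≤ _ := h2
      _ ≤ (x * growthFactor lam δ ^ j) * growthFactor lam δ := by
        have h0 := one_le_growthFactor hlam
        change _ * growthFactor lam δ ≤ _
        gcongr
        exact h1.trans (ih r hr')
      _ = _ := by ring

/-- On a path with exactly `n` fluctuations, the terminal liquidation value is at most
`x * growthFactor ^ n`. -/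
lemma liquidationValue_le_of_fluctuationCount_eq (hS : Continuous S) (hpos : ∀ t, 0 < S t)
    (hδ : 0 < δ) (hlam : (1 - lam) * Real.exp (2 * δ) < 1)
    (hf1 : IsCadlagPath f1) (hsf : IsSelfFinancingPath lam S x 0 f0 f1)
    (hadm : ∀ t, 0 ≤ liquidationValue lam (S t) (f0 t) (f1 t)) {n : ℕ}
    (hn : fluctuationCount δ (fun t => Real.log (S t)) = n) :
    liquidationValue lam (S ⟨T, self_mem_Iic⟩) (f0 ⟨T, self_mem_Iic⟩) (f1 ⟨T, self_mem_Iic⟩) ≤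
      x * growthFactor lam δ ^ n := by
  have hX : Continuous fun t => Real.log (S t) := hS.log fun t => (hpos t).ne'
  obtain ⟨s, hs⟩ := exists_coe_eq_fluctuationTime hX
    (fluctuationTime_ne_top_of_le_count hX hn.ge)
  have htop : fluctuationTime δ (fun t => Real.log (S t)) (n + 1) = ⊤ := by
    refine fluctuationTime_eq_top_of_count_lt hX ?_
    rw [hn]
    exact_mod_cast n.lt_succ_self
  have hosc : ∀ u, s ≤ u → u ≤ ⟨T, self_mem_Iic⟩ → |Real.log (S u) - Real.log (S s)| ≤ δ :=
    fun u hsu _ => (abs_log_sub_lt_of_lt_fluctuationTime (X := fun t => Real.log (S t)) hs hsu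
      (by rw [htop]; exact ENNReal.coe_lt_top)).le
  have hsT : s ≤ ⟨T, self_mem_Iic⟩ := s.2
  obtain ⟨h3, h4⟩ := bid_le_sub_and_add_le_ask (lam := lam) (hpos s)
    (hpos ⟨T, self_mem_Iic⟩) (hosc _ hsT le_rfl)
  have h5 : 0 < spreadRadius lam δ * S s := mul_pos (spreadRadius_pos hlam) (hpos s)
  calc _ ≤ _ := liquidationValue_le (p := spreadCenter lam δ * S s) (by linarith) (by linarith)
    _ ≤ _ := value_le_of_abs_log_le hS hpos hlam hf1 hsf hsT hosc
    _ ≤ _ := value_at_fluctuationTime_le hS hpos hδ hlam hf1 hsf hadm n s hs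

end Wealth

/-! ### Sums of signed increments of fractional Brownian motion -/

/-- `p` and `q` are convex combinations of `x` and `y` with mirrored weights; the two convexity
inequalities add up. -/
lemma ConvexOn.add_le_add_of_add_eq {s : Set ℝ} {f : ℝ → ℝ} (hf : ConvexOn ℝ s f)
    {x y p q : ℝ} (hx : x ∈ s) (hy : y ∈ s) (hxp : x ≤ p) (hpy : p ≤ y) (h : p + q = x + y) :
    f p + f q ≤ f x + f y := by
  rcases eq_or_lt_of_le (hxp.trans hpy) with rfl | hxy
  · have hp : p = x := le_antisymm hpy hxp
    have hq : q = x := by linarith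
    rw [hp, hq]
  have hd : 0 < y - x := by linarith
  set θ := (p - x) / (y - x) with hθ
  have h0 : 0 ≤ θ := div_nonneg (by linarith) hd.le
  have h1 : 0 ≤ 1 - θ := by
    rw [sub_nonneg, hθ, div_le_one hd]; linarith
  have hθd : θ * (y - x) = p - x := div_mul_cancel₀ _ hd.ne'
  have e1 := hf.2 hx hy h1 h0 (by ring)
  have e2 := hf.2 hx hy h0 h1 (by ring)
  simp only [smul_eq_mul] at e1 e2
  rw [show (1 - θ) * x + θ * y = p by linarith] at e1
  rw [show θ * x + (1 - θ) * y = q by linarith] at e2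
  linarith

/-- Jensen's inequality up to a factor `2`: the bound `y ^ h ≤ 1 + y` at `y = d i * n / T` suffices.
-/
lemma sum_rpow_le {n : ℕ} (hn : 0 < n) {d : Fin n → ℝ} (hd : ∀ i, 0 ≤ d i) {T h : ℝ} (hT : 0 < T)
    (hsum : ∑ i, d i ≤ T) (h0 : 0 < h) (h1 : h ≤ 1) :
    ∑ i, d i ^ h ≤ 2 * T ^ h * (n : ℝ) ^ (1 - h) := by
  have hn' : (0 : ℝ) < n := by exact_mod_cast hn
  have hterm : ∀ i, d i ^ h ≤ (T / n) ^ h * (1 + d i * (n / T)) := by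
    intro i
    have hx : 0 ≤ d i * (n / T) := mul_nonneg (hd i) (by positivity)
    have h2 : (d i * (n / T)) ^ h ≤ 1 + d i * (n / T) := by
      rcases le_total (d i * (n / T)) 1 with hle | hge
      · have := Real.rpow_le_one hx hle h0.le
        linarith
      · have := Real.rpow_le_rpow_of_exponent_le hge h1
        rw [Real.rpow_one] at this
        linarith
    calc d i ^ h = (T / n) ^ h * (d i * (n / T)) ^ h := by
          rw [← Real.mul_rpow (by positivity) hx]; congr 1; field_simp
      _ ≤ _ := by gcongr
  calc ∑ i, d i ^ h ≤ ∑ i, (T / n) ^ h * (1 + d i * (n / T)) := Finset.sum_le_sum fun i _ => hterm i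
    _ = (T / n) ^ h * (n + (∑ i, d i) * (n / T)) := by
      rw [← Finset.mul_sum, Finset.sum_add_distrib, ← Finset.sum_mul]; simp
    _ ≤ (T / n) ^ h * (n + T * (n / T)) := by gcongr
    _ = 2 * T ^ h * (n : ℝ) ^ (1 - h) := by
      rw [Real.div_rpow hT.le hn'.le, Real.rpow_sub hn', Real.rpow_one]
      field_simp
      ring

lemma Fin.sum_succ_sub_castSucc {n : ℕ} {M : Type*} [AddCommGroup M] (f : Fin (n + 1) → M) :
    ∑ i : Fin n, (f i.succ - f i.castSucc) = f (Fin.last n) - f 0 := by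
  rw [Finset.sum_sub_distrib, sub_eq_sub_iff_add_eq_add, add_comm, ← Fin.sum_univ_succ,
    Fin.sum_univ_castSucc, add_comm]

lemma variance_sum_mul_le {Ω : Type*} {m : MeasurableSpace Ω} {P : Measure Ω}
    [IsProbabilityMeasure P] {n : ℕ} {X : Fin n → Ω → ℝ} (hX : ∀ i, MemLp (X i) 2 P)
    {ε : Fin n → ℝ} (hε : ∀ i, |ε i| ≤ 1) :
    variance (fun ω => ∑ i, ε i * X i ω) P ≤ ∑ i, ∑ j, |covariance (X i) (X j) P| := by
  rw [variance_fun_sum fun i => (hX i).const_mul (ε i)]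
  refine Finset.sum_le_sum fun i _ => Finset.sum_le_sum fun j _ => ?_
  rw [covariance_const_mul_left, covariance_const_mul_right, ← mul_assoc]
  refine (le_abs_self _).trans ?_
  rw [abs_mul, abs_mul]
  exact mul_le_of_le_one_left (abs_nonneg _)
    (mul_le_one₀ (hε i) (abs_nonneg _) (hε j))

lemma hasSubgaussianMGF_of_hasGaussianLaw {Ω : Type*} {m : MeasurableSpace Ω} {P : Measure Ω}
    {Y : Ω → ℝ} (hY : HasGaussianLaw Y P) (h0 : ∫ ω, Y ω ∂P = 0) {V : ℝ≥0}
    (hV : variance Y P ≤ V) : HasSubgaussianMGF Y V P := by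
  have hmap := hY.map_eq_gaussianReal
  rw [h0] at hmap
  rw [← HasSubgaussianMGF.id_map_iff hY.aemeasurable, hmap]
  refine ⟨fun t => integrable_exp_mul_gaussianReal t, fun t => ?_⟩
  rw [mgf_id_gaussianReal, Real.exp_le_exp, zero_mul, zero_add]
  have : ((variance Y P).toNNReal : ℝ) ≤ V := by
    rw [Real.coe_toNNReal _ (variance_nonneg _ _)]; exact hV
  gcongr

namespace IsFractionalBrownianMotion

variable {Ω : Type*} {m : MeasurableSpace Ω} {P : Measure Ω} {T : ℝ≥0}
  {H : ℝ} {B : Iic T → Ω → ℝ}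

lemma memLp_two (hB : IsFractionalBrownianMotion H B P) (t : Iic T) : MemLp (B t) 2 P :=
  (hB.gaussian.hasGaussianLaw_eval t).memLp_two

lemma memLp_increment (hB : IsFractionalBrownianMotion H B P) (s t : Iic T) :
    MemLp (fun ω => B t ω - B s ω) 2 P :=
  (hB.memLp_two t).sub (hB.memLp_two s)

variable [IsProbabilityMeasure P]

lemma covariance_increment (hB : IsFractionalBrownianMotion H B P) (s t u v : Iic T) :
    covariance (fun ω => B t ω - B s ω) (fun ω => B v ω - B u ω) P =
      (|((v : ℝ≥0) : ℝ) - ((s : ℝ≥0) : ℝ)| ^ (2 * H) + |((u : ℝ≥0) : ℝ) - ((t : ℝ≥0) : ℝ)| ^ (2 * H)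
        - |((v : ℝ≥0) : ℝ) - ((t : ℝ≥0) : ℝ)| ^ (2 * H)
        - |((u : ℝ≥0) : ℝ) - ((s : ℝ≥0) : ℝ)| ^ (2 * H)) / 2 := by
  rw [covariance_fun_sub_fun_sub (hB.memLp_two t) (hB.memLp_two s) (hB.memLp_two v)
    (hB.memLp_two u), hB.covariance_eq, hB.covariance_eq, hB.covariance_eq, hB.covariance_eq]
  ring

lemma variance_increment (hB : IsFractionalBrownianMotion H B P) (hH : 0 < H) (s t : Iic T) :
    variance (fun ω => B t ω - B s ω) P = |((t : ℝ≥0) : ℝ) - ((s : ℝ≥0) : ℝ)| ^ (2 * H) := by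
  rw [← covariance_self (hB.memLp_increment s t).aemeasurable,
    hB.covariance_increment, sub_self, sub_self, abs_zero,
    Real.zero_rpow (by positivity : 2 * H ≠ 0), abs_sub_comm ((s : ℝ≥0) : ℝ)]
  ring

lemma integral_increment (hB : IsFractionalBrownianMotion H B P) (s t : Iic T) :
    ∫ ω, (B t ω - B s ω) ∂P = 0 := by
  rw [integral_sub ((hB.memLp_two t).integrable one_le_two)
    ((hB.memLp_two s).integrable one_le_two), hB.centered, hB.centered, sub_zero]

/-- The covariance compares `v - s` and `u - t` with `v - t` and `u - s`. Both pairs have the same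
sum and the first is more spread out, so convexity of `y ^ (2H)` gives the sign; for `2H ≤ 1`
concavity reverses it. -/
lemma covariance_increment_nonneg (hB : IsFractionalBrownianMotion H B P) (hH : 1 ≤ 2 * H)
    {s t u v : Iic T} (hst : s ≤ t) (htu : t ≤ u) (huv : u ≤ v) :
    0 ≤ covariance (fun ω => B t ω - B s ω) (fun ω => B v ω - B u ω) P := by
  have h1 : ((s : ℝ≥0) : ℝ) ≤ ((t : ℝ≥0) : ℝ) := by exact_mod_cast hst
  have h2 : ((t : ℝ≥0) : ℝ) ≤ ((u : ℝ≥0) : ℝ) := by exact_mod_cast htu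
  have h3 : ((u : ℝ≥0) : ℝ) ≤ ((v : ℝ≥0) : ℝ) := by exact_mod_cast huv
  rw [hB.covariance_increment, abs_of_nonneg (by linarith), abs_of_nonneg (by linarith),
    abs_of_nonneg (by linarith), abs_of_nonneg (by linarith)]
  have := (convexOn_rpow hH).add_le_add_of_add_eq
    (x := ((u : ℝ≥0) : ℝ) - ((t : ℝ≥0) : ℝ)) (y := ((v : ℝ≥0) : ℝ) - ((s : ℝ≥0) : ℝ))
    (p := ((v : ℝ≥0) : ℝ) - ((t : ℝ≥0) : ℝ)) (q := ((u : ℝ≥0) : ℝ) - ((s : ℝ≥0) : ℝ))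
    (mem_Ici.2 (by linarith)) (mem_Ici.2 (by linarith)) (by linarith) (by linarith) (by ring)
  linarith

lemma covariance_increment_nonpos (hB : IsFractionalBrownianMotion H B P) (hH0 : 0 < H)
    (hH : 2 * H ≤ 1) {s t u v : Iic T} (hst : s ≤ t) (htu : t ≤ u) (huv : u ≤ v) :
    covariance (fun ω => B t ω - B s ω) (fun ω => B v ω - B u ω) P ≤ 0 := by
  have h1 : ((s : ℝ≥0) : ℝ) ≤ ((t : ℝ≥0) : ℝ) := by exact_mod_cast hst
  have h2 : ((t : ℝ≥0) : ℝ) ≤ ((u : ℝ≥0) : ℝ) := by exact_mod_cast htu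
  have h3 : ((u : ℝ≥0) : ℝ) ≤ ((v : ℝ≥0) : ℝ) := by exact_mod_cast huv
  rw [hB.covariance_increment, abs_of_nonneg (by linarith), abs_of_nonneg (by linarith),
    abs_of_nonneg (by linarith), abs_of_nonneg (by linarith)]
  have := (Real.concaveOn_rpow (by positivity : 0 ≤ 2 * H) hH).neg.add_le_add_of_add_eq
    (x := ((u : ℝ≥0) : ℝ) - ((t : ℝ≥0) : ℝ)) (y := ((v : ℝ≥0) : ℝ) - ((s : ℝ≥0) : ℝ))
    (p := ((v : ℝ≥0) : ℝ) - ((t : ℝ≥0) : ℝ)) (q := ((u : ℝ≥0) : ℝ) - ((s : ℝ≥0) : ℝ))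
    (mem_Ici.2 (by linarith)) (mem_Ici.2 (by linarith)) (by linarith) (by linarith) (by ring)
  simp only [Pi.neg_apply] at this
  linarith

lemma sum_covariance_increment (hB : IsFractionalBrownianMotion H B P) (hH : 0 < H) {n : ℕ}
    (s : Fin (n + 1) → Iic T) :
    ∑ i : Fin n, ∑ j : Fin n, covariance (fun ω => B (s i.succ) ω - B (s i.castSucc) ω)
      (fun ω => B (s j.succ) ω - B (s j.castSucc) ω) P =
        |((s (Fin.last n) : ℝ≥0) : ℝ) - ((s 0 : ℝ≥0) : ℝ)| ^ (2 * H) := by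
  rw [← variance_fun_sum fun i => hB.memLp_increment _ _,
    ← hB.variance_increment hH]
  congr 1
  ext ω
  exact Fin.sum_succ_sub_castSucc fun i => B (s i) ω

lemma abs_sub_le (s t : Iic T) : |((t : ℝ≥0) : ℝ) - ((s : ℝ≥0) : ℝ)| ≤ T := by
  have h1 : ((s : ℝ≥0) : ℝ) ≤ T := by exact_mod_cast s.2
  have h2 : ((t : ℝ≥0) : ℝ) ≤ T := by exact_mod_cast t.2
  have h3 : 0 ≤ ((s : ℝ≥0) : ℝ) := NNReal.coe_nonneg _
  have h4 : 0 ≤ ((t : ℝ≥0) : ℝ) := NNReal.coe_nonneg _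
  rw [abs_le]
  constructor <;> linarith

/-- Off the diagonal all covariances have one sign. If `2H ≥ 1`, the absolute values are superfluous
and the double sum is the variance of the total increment. If `2H ≤ 1`, the sum is twice the
diagonal minus that variance, and the diagonal is bounded by `sum_rpow_le`. -/
lemma sum_abs_covariance_increment_le (hB : IsFractionalBrownianMotion H B P) (hH : 0 < H)
    (hT : 0 < T) {n : ℕ} (hn : 0 < n) {s : Fin (n + 1) → Iic T} (hs : Monotone s) :
    ∑ i : Fin n, ∑ j : Fin n, |covariance (fun ω => B (s i.succ) ω - B (s i.castSucc) ω)
      (fun ω => B (s j.succ) ω - B (s j.castSucc) ω) P| ≤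
        4 * (T : ℝ) ^ (2 * H) * (n : ℝ) ^ (1 - min (2 * H) 1) := by
  have hT' : (0 : ℝ) < T := hT
  have hn' : (0 : ℝ) < n := by exact_mod_cast hn
  set C : Fin n → Fin n → ℝ := fun i j =>
    covariance (fun ω => B (s i.succ) ω - B (s i.castSucc) ω)
      (fun ω => B (s j.succ) ω - B (s j.castSucc) ω) P with hC
  have hcomm : ∀ i j, C i j = C j i := fun i j => covariance_comm _ _
  have hdiag : ∀ i, C i i =
      |((s i.succ : ℝ≥0) : ℝ) - ((s i.castSucc : ℝ≥0) : ℝ)| ^ (2 * H) := fun i => by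
    rw [← hB.variance_increment hH, hC]
    exact covariance_self (hB.memLp_increment _ _).aemeasurable
  have hsum : ∑ i, ∑ j, C i j = |((s (Fin.last n) : ℝ≥0) : ℝ) - ((s 0 : ℝ≥0) : ℝ)| ^ (2 * H) :=
    hB.sum_covariance_increment hH s
  have hstep : ∀ i : Fin n, s i.castSucc ≤ s i.succ := fun i => hs (Fin.castSucc_lt_succ).le
  have hsep : ∀ {i j : Fin n}, i < j → s i.succ ≤ s j.castSucc := fun {i j} hij =>
    hs (by rw [Fin.le_def]; simpa using Nat.succ_le_of_lt hij)
  change ∑ i, ∑ j, |C i j| ≤ _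
  rcases le_total 1 (2 * H) with h1 | h1
  · have hnonneg : ∀ i j, 0 ≤ C i j := by
      intro i j
      rcases lt_trichotomy i j with hij | rfl | hij
      · exact hB.covariance_increment_nonneg h1 (hstep i) (hsep hij) (hstep j)
      · rw [hdiag]; positivity
      · rw [hcomm]
        exact hB.covariance_increment_nonneg h1 (hstep j) (hsep hij) (hstep i)
    simp_rw [abs_of_nonneg (hnonneg _ _)]
    rw [hsum, min_eq_right h1, sub_self, Real.rpow_zero, mul_one]
    have := Real.rpow_le_rpow (abs_nonneg _) (abs_sub_le (s 0) (s (Fin.last n)))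
      (by positivity : 0 ≤ 2 * H)
    have hTp : 0 < (T : ℝ) ^ (2 * H) := Real.rpow_pos_of_pos hT' _
    linarith
  · have habs : ∀ i j, |C i j| = (if i = j then 2 * C i i else 0) - C i j := by
      intro i j
      rcases lt_trichotomy i j with hij | rfl | hij
      · rw [if_neg hij.ne, abs_of_nonpos
          (hB.covariance_increment_nonpos hH h1 (hstep i) (hsep hij) (hstep j)), zero_sub]
      · rw [if_pos rfl, abs_of_nonneg (by rw [hdiag]; positivity)]
        ring
      · rw [if_neg hij.ne', hcomm, abs_of_nonpos
          (hB.covariance_increment_nonpos hH h1 (hstep j) (hsep hij) (hstep i)), zero_sub]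
    simp_rw [habs, Finset.sum_sub_distrib]
    rw [hsum]
    simp only [Finset.sum_ite_eq, Finset.mem_univ, if_true]
    rw [← Finset.mul_sum, min_eq_left h1]
    have hle : ∑ i, C i i ≤ 2 * (T : ℝ) ^ (2 * H) * (n : ℝ) ^ (1 - 2 * H) := by
      simp_rw [hdiag]
      refine sum_rpow_le hn (fun i => abs_nonneg _) hT' ?_ (by positivity) h1
      have : ∀ i : Fin n, |((s i.succ : ℝ≥0) : ℝ) - ((s i.castSucc : ℝ≥0) : ℝ)| =
          ((s i.succ : ℝ≥0) : ℝ) - ((s i.castSucc : ℝ≥0) : ℝ) := fun i =>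
        abs_of_nonneg (sub_nonneg.2 (by exact_mod_cast hstep i))
      simp_rw [this]
      rw [Fin.sum_succ_sub_castSucc fun i => ((s i : ℝ≥0) : ℝ)]
      exact (le_abs_self _).trans (abs_sub_le _ _)
    have : 0 ≤ |((s (Fin.last n) : ℝ≥0) : ℝ) - ((s 0 : ℝ≥0) : ℝ)| ^ (2 * H) := by positivity
    linarith

lemma hasSubgaussianMGF_increment (hB : IsFractionalBrownianMotion H B P) (hH : 0 < H)
    (s t : Iic T) : HasSubgaussianMGF (fun ω => B t ω - B s ω)
      ⟨|((t : ℝ≥0) : ℝ) - ((s : ℝ≥0) : ℝ)| ^ (2 * H), by positivity⟩ P :=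
  hasSubgaussianMGF_of_hasGaussianLaw hB.gaussian.hasGaussianLaw_fun_sub
    (hB.integral_increment s t) (hB.variance_increment hH s t).le

lemma hasSubgaussianMGF_sum (hB : IsFractionalBrownianMotion H B P) (hH : 0 < H)
    (hT : 0 < T) {n : ℕ} (hn : 0 < n) {s : Fin (n + 1) → Iic T} (hs : Monotone s)
    {ε : Fin n → ℝ} (hε : ∀ i, |ε i| ≤ 1) :
    HasSubgaussianMGF (fun ω => ∑ i, ε i * (B (s i.succ) ω - B (s i.castSucc) ω))
      ⟨4 * (T : ℝ) ^ (2 * H) * (n : ℝ) ^ (1 - min (2 * H) 1), by positivity⟩ P := by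
  refine hasSubgaussianMGF_of_hasGaussianLaw ?_ ?_ ?_
  · have := (hB.gaussian.hasGaussianLaw_increments (t := s)).map_fun
      (∑ i, ε i • ContinuousLinearMap.proj (R := ℝ) (φ := fun _ : Fin n => ℝ) i)
    simpa using this
  · rw [integral_finsetSum _ fun i _ => ?_]
    · refine Finset.sum_eq_zero fun i _ => ?_
      rw [integral_const_mul, hB.integral_increment, mul_zero]
    · exact ((hB.memLp_increment _ _).integrable one_le_two).const_mul _
  · exact (variance_sum_mul_le (fun i => hB.memLp_increment _ _) hε).trans
      (hB.sum_abs_covariance_increment_le hH hT hn hs)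

lemma measure_le_abs_increment (hB : IsFractionalBrownianMotion H B P) (hH : 0 < H)
    (s t : Iic T) {a : ℝ} (ha : 0 ≤ a) :
    P {ω | a ≤ |B t ω - B s ω|} ≤ ENNReal.ofReal
      (2 * Real.exp (-a ^ 2 / (2 * |((t : ℝ≥0) : ℝ) - ((s : ℝ≥0) : ℝ)| ^ (2 * H)))) := by
  have h1 := (hB.hasSubgaussianMGF_increment hH s t).measure_ge_le ha
  have h2 := (hB.hasSubgaussianMGF_increment hH s t).neg.measure_ge_le ha
  rw [← ofReal_measureReal]
  refine ENNReal.ofReal_le_ofReal ?_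
  have hsub : {ω | a ≤ |B t ω - B s ω|} ⊆
      {ω | a ≤ B t ω - B s ω} ∪ {ω | a ≤ (-fun ω => B t ω - B s ω) ω} := by
    intro ω hω
    exact le_abs.1 (mem_ofPred.1 hω)
  refine (measureReal_mono hsub).trans ((measureReal_union_le _ _).trans ?_)
  rw [two_mul]
  exact add_le_add h1 h2

/-- A sum of absolute values is the largest of the `2 ^ n` signed sums; each of these is
sub-Gaussian with the same variance proxy. -/
lemma measure_le_sum_abs_increment (hB : IsFractionalBrownianMotion H B P) (hH : 0 < H)
    (hT : 0 < T) {n : ℕ} (hn : 0 < n) {s : Fin (n + 1) → Iic T} (hs : Monotone s)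
    {a : ℝ} (ha : 0 ≤ a) :
    P {ω | a ≤ ∑ i : Fin n, |B (s i.succ) ω - B (s i.castSucc) ω|} ≤ ENNReal.ofReal
      (2 ^ n * Real.exp (-a ^ 2 /
        (2 * (4 * (T : ℝ) ^ (2 * H) * (n : ℝ) ^ (1 - min (2 * H) 1))))) := by
  rw [← ofReal_measureReal]
  refine ENNReal.ofReal_le_ofReal ?_
  let ε : (Fin n → Bool) → Fin n → ℝ := fun c i => if c i then 1 else -1
  have hε : ∀ c i, |ε c i| ≤ 1 := by
    intro c i
    by_cases h : c i <;> simp [ε, h]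
  have hsub : {ω | a ≤ ∑ i : Fin n, |B (s i.succ) ω - B (s i.castSucc) ω|} ⊆
      ⋃ c : Fin n → Bool,
        {ω | a ≤ ∑ i, ε c i * (B (s i.succ) ω - B (s i.castSucc) ω)} := by
    intro ω hω
    refine mem_iUnion.2 ⟨fun i => decide (0 ≤ B (s i.succ) ω - B (s i.castSucc) ω), ?_⟩
    refine le_trans (mem_ofPred.1 hω) (Finset.sum_le_sum fun i _ => ?_)
    by_cases h : 0 ≤ B (s i.succ) ω - B (s i.castSucc) ω
    · simp only [ε, h, decide_true, if_true, abs_of_nonneg, one_mul, le_refl]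
    · simp only [ε, h, decide_false, Bool.false_eq_true, if_false]
      rw [abs_of_neg (not_le.1 h)]
      linarith
  refine (measureReal_mono hsub).trans ((measureReal_iUnion_fintype_le _).trans ?_)
  refine (Finset.sum_le_sum fun c _ =>
    (hB.hasSubgaussianMGF_sum hH hT hn hs (hε c)).measure_ge_le ha).trans ?_
  simp only [Finset.sum_const, Finset.card_univ, Fintype.card_pi,
    Fintype.card_bool, Finset.prod_const, Fintype.card_fin, nsmul_eq_mul, Nat.cast_pow,
    Nat.cast_ofNat]
  exact le_rfl

end IsFractionalBrownianMotion

/-! ### Dyadic chaining -/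

/-- The roundings of `u` to levels `k` and `k + 1` are equal or neighbours at level `k + 1`, so the
successive errors are dominated by a geometric series; continuity identifies the limit. -/
lemma abs_sub_le_of_dyadic_increments {f : ℝ → ℝ} (hf : Continuous f) {w r : ℝ} (hw : 0 ≤ w)
    (hr0 : 0 < r) (hr1 : r < 1)
    (h : ∀ k i : ℕ, i < 2 ^ k → |f ((i + 1 : ℕ) / 2 ^ k) - f ((i : ℕ) / 2 ^ k)| ≤ w * r ^ k)
    {u : ℝ} (hu0 : 0 ≤ u) (hu1 : u ≤ 1) (k : ℕ) :
    |f (⌊u * 2 ^ k⌋₊ / 2 ^ k) - f u| ≤ w * r * r ^ k / (1 - r) := by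
  have hstep : ∀ k : ℕ, dist (f (⌊u * 2 ^ k⌋₊ / 2 ^ k)) (f (⌊u * 2 ^ (k + 1)⌋₊ / 2 ^ (k + 1))) ≤
      w * r * r ^ k := by
    intro k
    have hk : (0 : ℝ) < 2 ^ k := by positivity
    have e1 : ((2 * ⌊u * 2 ^ k⌋₊ : ℕ) : ℝ) / 2 ^ (k + 1) = ⌊u * 2 ^ k⌋₊ / 2 ^ k := by
      push_cast; rw [pow_succ]; field_simp
    have h1 : 2 * ⌊u * 2 ^ k⌋₊ ≤ ⌊u * 2 ^ (k + 1)⌋₊ := by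
      refine Nat.le_floor ?_
      have := Nat.floor_le (show 0 ≤ u * 2 ^ k by positivity)
      push_cast
      rw [pow_succ]
      linarith
    have h2 : ⌊u * 2 ^ (k + 1)⌋₊ < 2 * ⌊u * 2 ^ k⌋₊ + 2 := by
      refine (Nat.floor_lt (by positivity)).2 ?_
      have := Nat.lt_floor_add_one (u * 2 ^ k)
      push_cast
      rw [pow_succ]
      linarith
    have h3 : ⌊u * 2 ^ (k + 1)⌋₊ ≤ 2 ^ (k + 1) := by
      refine Nat.floor_le_of_le ?_
      push_cast
      exact mul_le_of_le_one_left (by positivity) hu1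
    rw [← e1]
    rcases (show ⌊u * 2 ^ (k + 1)⌋₊ = 2 * ⌊u * 2 ^ k⌋₊ ∨
        ⌊u * 2 ^ (k + 1)⌋₊ = 2 * ⌊u * 2 ^ k⌋₊ + 1 by omega) with h4 | h4
    · rw [h4, dist_self]; positivity
    · rw [h4, dist_comm, Real.dist_eq]
      refine (h (k + 1) _ (by omega)).trans (le_of_eq ?_)
      rw [pow_succ]; ring
  have hlim : Tendsto (fun k : ℕ => f (⌊u * 2 ^ k⌋₊ / 2 ^ k)) atTop (𝓝 (f u)) := by
    refine (hf.tendsto u).comp ?_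
    exact (tendsto_nat_floor_mul_div_atTop hu0).comp
      (tendsto_pow_atTop_atTop_of_one_lt (one_lt_two (α := ℝ)))
  exact dist_le_of_le_geometric_of_tendsto r (w * r) hr1 hstep hlim k

/-- The dyadic point `T i / 2 ^ k`. -/
noncomputable def dyadicTime (T : ℝ≥0) (k i : ℕ) : Iic T := clampTime T (T * (i / 2 ^ k))

lemma coe_dyadicTime (T : ℝ≥0) {k i : ℕ} (hi : i ≤ 2 ^ k) :
    ((dyadicTime T k i : ℝ≥0) : ℝ) = T * (i / 2 ^ k) := by
  refine coe_clampTime (by positivity) (mul_le_of_le_one_right T.2 ?_)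
  rw [div_le_one (by positivity)]
  exact_mod_cast hi

lemma monotone_dyadicTime (T : ℝ≥0) (k : ℕ) : Monotone (dyadicTime T k) := fun i j hij =>
  monotone_clampTime T (by gcongr)

namespace IsFractionalBrownianMotion

variable {Ω : Type*} {m : MeasurableSpace Ω} {P : Measure Ω} [IsProbabilityMeasure P] {T : ℝ≥0}
  {H : ℝ} {B : Iic T → Ω → ℝ}

/-- The dyadic increments of fractional Brownian motion are uniformly Hölder continuous of order
`H / 2`, with a constant that has Gaussian tails. -/
lemma exists_measure_dyadic_increments_le (hB : IsFractionalBrownianMotion H B P) (hH : 0 < H)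
    (hT : 0 < T) {r : ℝ} (hr : r = (2 : ℝ) ^ (-(H / 2))) :
    ∃ c > 0, ∃ w₀, ∀ w ≥ w₀,
      P {ω | ∃ k i : ℕ, i < 2 ^ k ∧
        w * r ^ k ≤ |B (dyadicTime T k (i + 1)) ω - B (dyadicTime T k i) ω|} ≤
      ENNReal.ofReal (4 * Real.exp (-c * w ^ 2)) := by
  have hT' : (0 : ℝ) < T := hT
  have hr0 : 0 < r := hr ▸ Real.rpow_pos_of_pos two_pos _
  have hr1 : r < 1 := hr ▸ Real.rpow_lt_one_of_one_lt_of_neg one_lt_two (by linarith)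
  -- The variance of an increment drops by `r ^ 4` per level and the squared threshold only by `r ^
  -- 2`, so the Gaussian exponent grows by the factor `q = r ^ (-2) > 1`.
  have hr4 : r ^ 4 = ((2 : ℝ)⁻¹) ^ (2 * H) := by
    rw [hr, ← Real.rpow_natCast, ← Real.rpow_mul two_pos.le, Real.inv_rpow two_pos.le,
      ← Real.rpow_neg two_pos.le]
    congr 1; push_cast; ring
  have hTH : 0 < (T : ℝ) ^ (2 * H) := Real.rpow_pos_of_pos hT' _
  set c : ℝ := 1 / (2 * (T : ℝ) ^ (2 * H)) with hc
  have hc0 : 0 < c := by positivity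
  set q : ℝ := (r ^ 2)⁻¹ with hq
  have hq1 : 1 < q := (one_lt_inv₀ (by positivity)).2 (by nlinarith)
  -- This `w₀` forces `c * w ^ 2 * (q - 1) ≥ 2`, so that by Bernoulli's inequality each level gains
  -- a factor `1 / 4`, against the `2 ^ k` increments of level `k`.
  refine ⟨c, hc0, max 1 (2 / (c * (q - 1))), fun w hw => ?_⟩
  have hw1 : 1 ≤ w := (le_max_left _ _).trans hw
  have hw2 : 2 ≤ c * w ^ 2 * (q - 1) := by
    have h1 := (le_max_right _ _).trans hw
    rw [div_le_iff₀ (mul_pos hc0 (by linarith))] at h1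
    have : w ≤ w ^ 2 := by nlinarith
    have h2 : w * (c * (q - 1)) ≤ w ^ 2 * (c * (q - 1)) :=
      mul_le_mul_of_nonneg_right this (mul_pos hc0 (by linarith)).le
    linarith
  have hquarter : Real.exp (-(c * w ^ 2 * (q - 1))) ≤ 1 / 4 := by
    have h2 : (4 : ℝ) ≤ Real.exp 2 := by
      have h1 : (2 : ℝ) ≤ Real.exp 1 := by
        have := Real.add_one_le_exp (1 : ℝ); linarith
      have h3 : Real.exp 2 = Real.exp 1 * Real.exp 1 := by rw [← Real.exp_add]; norm_num
      rw [h3]; nlinarith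
    calc _ ≤ Real.exp (-2) := Real.exp_le_exp.2 (by linarith)
      _ ≤ 1 / 4 := by
        rw [Real.exp_neg, ← one_div]
        exact one_div_le_one_div_of_le (by norm_num) h2
  have hterm : ∀ k i : ℕ, i < 2 ^ k →
      P {ω | w * r ^ k ≤ |B (dyadicTime T k (i + 1)) ω - B (dyadicTime T k i) ω|} ≤
        ENNReal.ofReal (2 * Real.exp (-c * w ^ 2) * (1 / 4) ^ k) := by
    intro k i hi
    refine (hB.measure_le_abs_increment hH _ _ (by positivity)).trans
      (ENNReal.ofReal_le_ofReal ?_)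
    rw [coe_dyadicTime T hi, coe_dyadicTime T hi.le]
    have hd : |(T : ℝ) * (((i + 1 : ℕ) : ℝ) / 2 ^ k) - T * ((i : ℝ) / 2 ^ k)| ^ (2 * H) =
        (T : ℝ) ^ (2 * H) * (r ^ 4) ^ k := by
      have : (T : ℝ) * (((i + 1 : ℕ) : ℝ) / 2 ^ k) - T * ((i : ℝ) / 2 ^ k) =
          T * (2⁻¹ : ℝ) ^ k := by
        push_cast; rw [inv_pow]; field_simp; ring
      rw [this, abs_of_pos (by positivity), Real.mul_rpow hT'.le (by positivity), hr4,
        ← Real.rpow_natCast, ← Real.rpow_natCast, ← Real.rpow_mul (by norm_num),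
        ← Real.rpow_mul (by norm_num), mul_comm (k : ℝ)]
    rw [hd]
    have hexp : -(w * r ^ k) ^ 2 / (2 * ((T : ℝ) ^ (2 * H) * (r ^ 4) ^ k)) =
        -(c * w ^ 2 * q ^ k) := by
      rw [hc, hq, inv_pow, ← pow_mul, ← pow_mul]
      field_simp
      ring
    have hbern : 1 + k * (q - 1) ≤ q ^ k := by
      have := one_add_mul_le_pow (a := q - 1) (by linarith) k
      simpa using this
    rw [hexp, mul_assoc (2 : ℝ)]
    refine mul_le_mul_of_nonneg_left ?_ two_pos.le
    calc Real.exp (-(c * w ^ 2 * q ^ k))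
        ≤ Real.exp (-c * w ^ 2 + k * (-(c * w ^ 2 * (q - 1)))) := by
          refine Real.exp_le_exp.2 ?_
          have := mul_le_mul_of_nonneg_left hbern (by positivity : 0 ≤ c * w ^ 2)
          linarith
      _ = Real.exp (-c * w ^ 2) * Real.exp (-(c * w ^ 2 * (q - 1))) ^ k := by
          rw [Real.exp_add, Real.exp_nat_mul]
      _ ≤ _ := by gcongr
  have hsub : {ω | ∃ k i : ℕ, i < 2 ^ k ∧
      w * r ^ k ≤ |B (dyadicTime T k (i + 1)) ω - B (dyadicTime T k i) ω|} ⊆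
      ⋃ k : ℕ, ⋃ i ∈ Finset.range (2 ^ k),
        {ω | w * r ^ k ≤ |B (dyadicTime T k (i + 1)) ω - B (dyadicTime T k i) ω|} := by
    rintro ω ⟨k, i, hi, h⟩
    exact mem_iUnion.2 ⟨k, mem_iUnion₂.2 ⟨i, Finset.mem_range.2 hi, h⟩⟩
  have hsum : HasSum (fun k : ℕ => 2 * Real.exp (-c * w ^ 2) * (1 / 2) ^ k)
      (4 * Real.exp (-c * w ^ 2)) := by
    have := hasSum_geometric_two.mul_left (2 * Real.exp (-c * w ^ 2))
    convert! this using 1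
    ring
  calc _ ≤ _ := measure_mono hsub
    _ ≤ ∑' k : ℕ, P (⋃ i ∈ Finset.range (2 ^ k),
        {ω | w * r ^ k ≤ |B (dyadicTime T k (i + 1)) ω - B (dyadicTime T k i) ω|}) :=
      measure_iUnion_le _
    _ ≤ ∑' k : ℕ, ENNReal.ofReal (2 * Real.exp (-c * w ^ 2) * (1 / 2) ^ k) := by
      refine ENNReal.tsum_le_tsum fun k => ?_
      refine (measure_biUnion_finset_le _ _).trans ?_
      refine (Finset.sum_le_sum fun i hi => hterm k i (Finset.mem_range.1 hi)).trans ?_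
      rw [Finset.sum_const, Finset.card_range, nsmul_eq_mul,
        ← ENNReal.ofReal_natCast, ← ENNReal.ofReal_mul (by positivity)]
      refine ENNReal.ofReal_le_ofReal (le_of_eq ?_)
      rw [show (1 / 2 : ℝ) = 2 * (1 / 4) by norm_num, mul_pow]
      push_cast
      ring
    _ = ENNReal.ofReal (4 * Real.exp (-c * w ^ 2)) := by
      rw [← ENNReal.ofReal_tsum_of_nonneg (fun k => by positivity) hsum.summable, hsum.tsum_eq]

/-- The probability that the increments of fractional Brownian motion along some `n + 1` increasing
dyadic times of level `k` sum up to `a` in absolute value. -/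
lemma measure_exists_dyadic_sum_le (hB : IsFractionalBrownianMotion H B P) (hH : 0 < H)
    (hT : 0 < T) {n : ℕ} (hn : 0 < n) (k : ℕ) {a : ℝ} (ha : 0 ≤ a) :
    P {ω | ∃ l : Fin (n + 1) → Fin (2 ^ k + 1), Monotone l ∧
      a ≤ ∑ i : Fin n, |B (dyadicTime T k (l i.succ)) ω - B (dyadicTime T k (l i.castSucc)) ω|} ≤
    ENNReal.ofReal ((2 ^ k + 1) ^ (n + 1) * (2 ^ n * Real.exp (-a ^ 2 /
        (2 * (4 * (T : ℝ) ^ (2 * H) * (n : ℝ) ^ (1 - min (2 * H) 1)))))) := by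
  set v := 2 ^ n * Real.exp (-a ^ 2 /
        (2 * (4 * (T : ℝ) ^ (2 * H) * (n : ℝ) ^ (1 - min (2 * H) 1))))
  have hsub : {ω | ∃ l : Fin (n + 1) → Fin (2 ^ k + 1), Monotone l ∧
      a ≤ ∑ i : Fin n, |B (dyadicTime T k (l i.succ)) ω - B (dyadicTime T k (l i.castSucc)) ω|} ⊆
      ⋃ l ∈ (Finset.univ : Finset (Fin (n + 1) → Fin (2 ^ k + 1))), {ω | Monotone l ∧
      a ≤ ∑ i : Fin n,
        |B (dyadicTime T k (l i.succ)) ω - B (dyadicTime T k (l i.castSucc)) ω|} := by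
    rintro ω ⟨l, hl⟩
    exact mem_iUnion₂.2 ⟨l, Finset.mem_univ _, hl⟩
  refine (measure_mono hsub).trans ((measure_biUnion_finset_le _ _).trans ?_)
  have hterm : ∀ l : Fin (n + 1) → Fin (2 ^ k + 1), P {ω | Monotone l ∧ a ≤ ∑ i : Fin n,
      |B (dyadicTime T k (l i.succ)) ω - B (dyadicTime T k (l i.castSucc)) ω|} ≤
        ENNReal.ofReal v := by
    intro l
    by_cases hl : Monotone l
    · simp only [hl, true_and]
      exact hB.measure_le_sum_abs_increment hH hT hn
        (s := fun i => dyadicTime T k (l i)) (fun i j hij => monotone_dyadicTime T k (hl hij)) ha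
    · simp [hl]
  refine (Finset.sum_le_sum fun l _ => hterm l).trans (le_of_eq ?_)
  rw [Finset.sum_const, Finset.card_univ, nsmul_eq_mul,
    ENNReal.ofReal_mul (q := v) (by positivity), ← ENNReal.ofReal_natCast]
  congr 2
  simp

end IsFractionalBrownianMotion

/-! ### Exponential moments of the number of fluctuations -/

/-- The choice `k n = ⌈n ^ (ν / 2)⌉` makes the rounding error `n * r ^ k n` tend to `0` while `k n`
stays of lower order than `n ^ ν`. -/
lemma exists_level {ν A L r C : ℝ} (hν : 0 < ν) (hA : 0 < A) (hr0 : 0 < r) (hr1 : r < 1)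
    (hC : 0 < C) : ∃ k : ℕ → ℕ, ∀ᶠ n : ℕ in atTop,
      (n : ℝ) * r ^ k n ≤ C ∧ 2 * (k n : ℝ) + 3 + L ≤ A * (n : ℝ) ^ ν := by
  have hy : Tendsto (fun n : ℕ => (n : ℝ) ^ (ν / 2)) atTop atTop :=
    (tendsto_rpow_atTop (by positivity)).comp tendsto_natCast_atTop_atTop
  refine ⟨fun n => ⌈(n : ℝ) ^ (ν / 2)⌉₊, ?_⟩
  have h1 : ∀ᶠ y : ℝ in atTop, y ^ (2 / ν) * Real.exp (-(-Real.log r) * y) < C :=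
    (tendsto_rpow_mul_exp_neg_mul_atTop_nhds_zero (2 / ν) (-Real.log r)
      (by linarith [Real.log_neg hr0 hr1])).eventually_lt_const hC
  -- With `k ≤ y + 1` and `y ≥ 1`, `2 * k + 3 + L ≤ (7 + |L|) * y`.
  filter_upwards [hy.eventually h1, hy.eventually_ge_atTop 1,
    hy.eventually_ge_atTop ((7 + |L|) / A)] with n hn1 hn2 hn3
  set y := (n : ℝ) ^ (ν / 2)
  have hyn : y ^ (2 / ν) = n := by
    rw [← Real.rpow_mul n.cast_nonneg, div_mul_div_comm, mul_comm ν 2, div_self (by positivity),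
      Real.rpow_one]
  have hyν : y ^ 2 = (n : ℝ) ^ ν := by
    rw [← Real.rpow_natCast, ← Real.rpow_mul n.cast_nonneg]; congr 1; push_cast; ring
  constructor
  · refine le_trans ?_ hn1.le
    rw [hyn]
    gcongr
    calc r ^ ⌈y⌉₊ = r ^ ((⌈y⌉₊ : ℕ) : ℝ) := (Real.rpow_natCast _ _).symm
      _ ≤ r ^ y := Real.rpow_le_rpow_of_exponent_ge hr0 hr1.le (Nat.le_ceil y)
      _ = Real.exp (-(-Real.log r) * y) := by rw [Real.rpow_def_of_pos hr0, neg_neg]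
  · have hk := (Nat.ceil_lt_add_one (show 0 ≤ y by linarith)).le
    rw [div_le_iff₀ hA] at hn3
    rw [← hyν]
    have h5 : (7 + |L|) * y ≤ A * y ^ 2 := by nlinarith
    have h6 : L ≤ |L| * y := by
      have := le_abs_self L
      nlinarith [abs_nonneg L]
    linarith

/-- The fluctuation times are rounded down to the grid. Each rounding costs at most the chaining
error at both ends of an increment, and the drift telescopes to at most `|μ| * T` in total. -/
lemma sum_abs_dyadic_ge {T : ℝ≥0} (hT : 0 < T) {b : Iic T → ℝ} (hb : Continuous b)
    {μ σ δ w r : ℝ} (hσ : 0 < σ) (hw : 0 ≤ w) (hr0 : 0 < r) (hr1 : r < 1)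
    (hdy : ∀ k i : ℕ, i < 2 ^ k →
      |b (dyadicTime T k (i + 1)) - b (dyadicTime T k i)| ≤ w * r ^ k)
    {n : ℕ} (hF : (n : ℕ∞) ≤ fluctuationCount δ fun t => μ * ((t : ℝ≥0) : ℝ) + σ * b t) (k : ℕ) :
    ∃ l : Fin (n + 1) → Fin (2 ^ k + 1), Monotone l ∧
      (n * δ - |μ| * T) / σ - 2 * n * (w * r * r ^ k / (1 - r)) ≤
        ∑ i : Fin n, |b (dyadicTime T k (l i.succ)) - b (dyadicTime T k (l i.castSucc))| := by
  have hT' : (0 : ℝ) < T := hT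
  obtain ⟨τ, hτ, hτd⟩ := exists_times_of_le_fluctuationCount (by fun_prop) hF
  let u : Fin (n + 1) → ℝ := fun i => ((τ i : ℝ≥0) : ℝ) / T
  have hu0 : ∀ i, 0 ≤ u i := fun i => by positivity
  have hu1 : ∀ i, u i ≤ 1 := fun i => by
    rw [div_le_one hT']; exact_mod_cast (τ i).2
  have huτ : ∀ i, clampTime T (T * u i) = τ i := fun i => by
    rw [mul_div_cancel₀ _ hT'.ne', clampTime_coe]
  have hfl : ∀ i, ⌊u i * 2 ^ k⌋₊ < 2 ^ k + 1 := fun i => by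
    refine Nat.lt_succ_of_le (Nat.floor_le_of_le ?_)
    push_cast
    exact mul_le_of_le_one_left (by positivity) (hu1 i)
  set e := w * r * r ^ k / (1 - r)
  have happ : ∀ i, |b (dyadicTime T k ⌊u i * 2 ^ k⌋₊) - b (τ i)| ≤ e := by
    intro i
    have := abs_sub_le_of_dyadic_increments (f := fun v => b (clampTime T (T * v)))
      (hb.comp ((continuous_clampTime T).comp (by fun_prop))) hw hr0 hr1 hdy (hu0 i) (hu1 i) k
    simp only [huτ] at this
    exact this
  refine ⟨fun i => ⟨⌊u i * 2 ^ k⌋₊, hfl i⟩, fun i j hij => ?_, ?_⟩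
  · refine Fin.mk_le_mk.2 (Nat.floor_le_floor ?_)
    have : ((τ i : ℝ≥0) : ℝ) ≤ ((τ j : ℝ≥0) : ℝ) := by exact_mod_cast hτ hij
    gcongr
    exact div_le_div_of_nonneg_right this hT'.le
  have hstep : ∀ i : Fin n, δ / σ - |μ| / σ * (((τ i.succ : ℝ≥0) : ℝ) - ((τ i.castSucc : ℝ≥0) : ℝ))
      - 2 * e ≤ |b (dyadicTime T k ⌊u i.succ * 2 ^ k⌋₊) -
        b (dyadicTime T k ⌊u i.castSucc * 2 ^ k⌋₊)| := by
    intro i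
    have h1 := hτd i
    have hmono : ((τ i.castSucc : ℝ≥0) : ℝ) ≤ ((τ i.succ : ℝ≥0) : ℝ) := by
      exact_mod_cast hτ (Fin.castSucc_lt_succ).le
    have h2 : δ ≤ |μ| * (((τ i.succ : ℝ≥0) : ℝ) - ((τ i.castSucc : ℝ≥0) : ℝ)) +
        σ * |b (τ i.succ) - b (τ i.castSucc)| := by
      refine h1.trans ?_
      rw [show μ * ((τ i.succ : ℝ≥0) : ℝ) + σ * b (τ i.succ) -
        (μ * ((τ i.castSucc : ℝ≥0) : ℝ) + σ * b (τ i.castSucc)) =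
        μ * (((τ i.succ : ℝ≥0) : ℝ) - ((τ i.castSucc : ℝ≥0) : ℝ)) +
        σ * (b (τ i.succ) - b (τ i.castSucc)) by ring]
      refine (abs_add_le _ _).trans (le_of_eq ?_)
      rw [abs_mul, abs_mul, abs_of_pos hσ, abs_of_nonneg (sub_nonneg.2 hmono)]
    have h3 : δ / σ - |μ| / σ * (((τ i.succ : ℝ≥0) : ℝ) - ((τ i.castSucc : ℝ≥0) : ℝ)) ≤
        |b (τ i.succ) - b (τ i.castSucc)| := by
      rw [div_mul_eq_mul_div, ← sub_div, div_le_iff₀ hσ]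
      linarith
    have h4 : |b (τ i.succ) - b (τ i.castSucc)| ≤
        |b (dyadicTime T k ⌊u i.succ * 2 ^ k⌋₊) - b (dyadicTime T k ⌊u i.castSucc * 2 ^ k⌋₊)| +
          2 * e := by
      have h5 := happ i.succ
      have h6 := happ i.castSucc
      rw [abs_le] at h5 h6
      refine abs_le.2 ⟨?_, ?_⟩
      · have := neg_abs_le (b (dyadicTime T k ⌊u i.succ * 2 ^ k⌋₊) -
          b (dyadicTime T k ⌊u i.castSucc * 2 ^ k⌋₊))
        linarith
      · have := le_abs_self (b (dyadicTime T k ⌊u i.succ * 2 ^ k⌋₊) -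
          b (dyadicTime T k ⌊u i.castSucc * 2 ^ k⌋₊))
        linarith
    linarith
  refine le_trans ?_ (Finset.sum_le_sum fun i _ => hstep i)
  rw [Finset.sum_sub_distrib, Finset.sum_sub_distrib, ← Finset.mul_sum,
    Fin.sum_succ_sub_castSucc fun i => ((τ i : ℝ≥0) : ℝ)]
  simp only [Finset.sum_const, Finset.card_univ, Fintype.card_fin, nsmul_eq_mul]
  have h7 : |μ| / σ * (((τ (Fin.last n) : ℝ≥0) : ℝ) - ((τ 0 : ℝ≥0) : ℝ)) ≤ |μ| / σ * T := by
    gcongr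
    exact (le_abs_self _).trans (IsFractionalBrownianMotion.abs_sub_le _ _)
  have h8 : (n * δ - |μ| * T) / σ = n * (δ / σ) - |μ| / σ * T := by ring
  rw [h8]
  linarith

/-- Either some dyadic increment exceeds its threshold with `w = n`, at probability of order `exp
(-c n ^ 2)`, or the rounded times in the grid of level `k n` witness a large sum of absolute
increments. -/
lemma IsFractionalBrownianMotion.eventually_measure_le_fluctuationCount {Ω : Type*}
    {m : MeasurableSpace Ω} {P : Measure Ω} [IsProbabilityMeasure P] {T : ℝ≥0} {H : ℝ}
    {B : Iic T → Ω → ℝ} (hB : IsFractionalBrownianMotion H B P) (hH : 0 < H) (hT : 0 < T)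
    {μ σ δ : ℝ} (hσ : 0 < σ) (hδ : 0 < δ) (L : ℝ) :
    ∀ᶠ n : ℕ in atTop,
      P {ω | (n : ℕ∞) ≤ fluctuationCount δ fun t => μ * ((t : ℝ≥0) : ℝ) + σ * B t ω} ≤
        ENNReal.ofReal (5 * Real.exp (-L * n)) := by
  have hT' : (0 : ℝ) < T := hT
  set r : ℝ := (2 : ℝ) ^ (-(H / 2)) with hr
  have hr0 : 0 < r := Real.rpow_pos_of_pos two_pos _
  have hr1 : r < 1 := Real.rpow_lt_one_of_one_lt_of_neg one_lt_two (by linarith)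
  obtain ⟨c, hc, w₀, hw₀⟩ := hB.exists_measure_dyadic_increments_le hH hT hr
  set ν := min (2 * H) 1 with hν
  have hν0 : 0 < ν := lt_min (by positivity) one_pos
  -- Half of `δ / σ` per fluctuation is kept; a quarter pays for the drift and a quarter for the
  -- rounding.
  set η := δ / (2 * σ) with hη
  have hη0 : 0 < η := by positivity
  set V := 4 * (T : ℝ) ^ (2 * H) with hV
  have hV0 : 0 < V := by positivity
  obtain ⟨k, hk⟩ := exists_level (ν := ν) (A := η ^ 2 / (2 * V)) (L := L) (r := r)
    (C := δ / (8 * σ) * (1 - r)) hν0 (by positivity) hr0 hr1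
    (mul_pos (by positivity) (by linarith))
  filter_upwards [hk, eventually_ge_atTop 1,
    tendsto_natCast_atTop_atTop.eventually_ge_atTop w₀,
    tendsto_natCast_atTop_atTop.eventually_ge_atTop (L / c),
    tendsto_natCast_atTop_atTop.eventually_ge_atTop (4 * |μ| * T / δ)]
    with n ⟨hk1, hk2⟩ hn1 hnw hnL hnμ
  have hn0 : (0 : ℝ) < n := by exact_mod_cast hn1
  rw [div_le_iff₀ hc] at hnL
  rw [div_le_iff₀ hδ] at hnμ
  have hsub : {ω | (n : ℕ∞) ≤ fluctuationCount δ fun t => μ * ((t : ℝ≥0) : ℝ) + σ * B t ω} ≤ᵐ[P]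
      ({ω | ∃ k i : ℕ, i < 2 ^ k ∧
        (n : ℝ) * r ^ k ≤ |B (dyadicTime T k (i + 1)) ω - B (dyadicTime T k i) ω|} ∪
      {ω | ∃ l : Fin (n + 1) → Fin (2 ^ k n + 1), Monotone l ∧ n * η ≤ ∑ i : Fin n,
        |B (dyadicTime T (k n) (l i.succ)) ω - B (dyadicTime T (k n) (l i.castSucc)) ω|} :
          Set Ω) := by
    filter_upwards [hB.continuous_paths] with ω hω hF
    by_cases hdy : ∃ k i : ℕ, i < 2 ^ k ∧
        (n : ℝ) * r ^ k ≤ |B (dyadicTime T k (i + 1)) ω - B (dyadicTime T k i) ω|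
    · exact Or.inl hdy
    · right
      push Not at hdy
      obtain ⟨l, hl, hsum⟩ := sum_abs_dyadic_ge hT hω hσ hn0.le hr0 hr1
        (fun k i hi => (hdy k i hi).le) hF (k n)
      refine ⟨l, hl, le_trans ?_ hsum⟩
      have h1 : (n : ℝ) * r * r ^ k n / (1 - r) ≤ δ / (8 * σ) := by
        rw [div_le_iff₀ (by linarith)]
        refine le_trans ?_ hk1
        have : (0 : ℝ) ≤ n * r ^ k n := by positivity
        nlinarith
      have h2 : (n * δ - |μ| * T) / σ ≥ n * δ * (3 / 4) / σ := by
        gcongr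
        linarith
      have h3 : 2 * (n : ℝ) * (n * r * r ^ k n / (1 - r)) ≤ 2 * n * (δ / (8 * σ)) := by gcongr
      have h4 : n * δ * (3 / 4) / σ - 2 * n * (δ / (8 * σ)) = n * η := by
        rw [hη]; field_simp; ring
      linarith
  have hA := hw₀ n hnw
  have hD := hB.measure_exists_dyadic_sum_le hH hT hn1 (k n) (a := n * η) (by positivity)
  refine (measure_mono_ae hsub).trans ((measure_union_le _ _).trans ((add_le_add hA hD).trans ?_))
  rw [← ENNReal.ofReal_add (by positivity) (by positivity)]
  refine ENNReal.ofReal_le_ofReal ?_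
  have hA' : Real.exp (-c * (n : ℝ) ^ 2) ≤ Real.exp (-L * n) := by
    refine Real.exp_le_exp.2 ?_
    nlinarith
  have h2e : (2 : ℝ) ≤ Real.exp 1 := by
    have := Real.add_one_le_exp (1 : ℝ); linarith
  have hD' : (2 ^ k n + 1) ^ (n + 1) * (2 ^ n * Real.exp (-(n * η) ^ 2 /
      (2 * (V * (n : ℝ) ^ (1 - ν))))) ≤ Real.exp (-L * n) := by
    have e1 : -(n * η) ^ 2 / (2 * (V * (n : ℝ) ^ (1 - ν))) =
        -(n * (η ^ 2 / (2 * V) * (n : ℝ) ^ ν)) := by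
      rw [Real.rpow_sub hn0, Real.rpow_one]
      field_simp
    have e2 : ((2 : ℝ) ^ k n + 1) ≤ Real.exp (k n + 1) := by
      have h1 : (1 : ℝ) ≤ 2 ^ k n := one_le_pow₀ one_le_two
      calc ((2 : ℝ) ^ k n + 1) ≤ 2 ^ (k n + 1) := by rw [pow_succ]; linarith
        _ ≤ Real.exp 1 ^ (k n + 1) := by gcongr
        _ = Real.exp (k n + 1) := by rw [← Real.exp_nat_mul]; simp
    have e3 : (2 : ℝ) ^ n ≤ Real.exp n := by
      calc (2 : ℝ) ^ n ≤ Real.exp 1 ^ n := by gcongr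
        _ = Real.exp n := by rw [← Real.exp_nat_mul]; simp
    calc _ ≤ Real.exp (k n + 1) ^ (n + 1) * (Real.exp n *
          Real.exp (-(n * (η ^ 2 / (2 * V) * (n : ℝ) ^ ν)))) := by
          rw [e1]; gcongr
      _ = Real.exp ((n + 1) * (k n + 1) + (n + -(n * (η ^ 2 / (2 * V) * (n : ℝ) ^ ν)))) := by
          rw [← Real.exp_nat_mul, ← Real.exp_add, ← Real.exp_add]; push_cast; rfl
      -- Grid choices cost at most `n * (2 * k n + 2)` in the exponent and signs cost `n`, which is
      -- where `2 * k n + 3 + L` comes from.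
      _ ≤ Real.exp (-L * n) := by
          refine Real.exp_le_exp.2 ?_
          have h1 : (1 : ℝ) ≤ n := by exact_mod_cast hn1
          have h2 := mul_le_mul_of_nonneg_left hk2 hn0.le
          have h3 : ((n : ℝ) + 1) * (k n + 1) ≤ 2 * n * (k n + 1) := by gcongr; linarith
          linarith
  linarith

/-- The fluctuation count has exponential moments of all orders. -/
lemma IsFractionalBrownianMotion.tsum_pow_mul_measure_lt_top {Ω : Type*}
    {m : MeasurableSpace Ω} {P : Measure Ω} [IsProbabilityMeasure P] {T : ℝ≥0} {H : ℝ}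
    {B : Iic T → Ω → ℝ} (hB : IsFractionalBrownianMotion H B P) (hH : 0 < H) (hT : 0 < T)
    {μ σ δ : ℝ} (hσ : 0 < σ) (hδ : 0 < δ) {K : ℝ} (hK : 0 < K) :
    ∑' n : ℕ, ENNReal.ofReal (K ^ n) *
      P {ω | (n : ℕ∞) ≤ fluctuationCount δ fun t => μ * ((t : ℝ≥0) : ℝ) + σ * B t ω} < ⊤ := by
  -- The rate `L = log (2K)` turns the tail of the series into a multiple of `∑ 2 ^ (-n)`.
  obtain ⟨N, hN⟩ := eventually_atTop.1
    (hB.eventually_measure_le_fluctuationCount hH hT (μ := μ) hσ hδ (Real.log (2 * K)))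
  rw [← ENNReal.summable.sum_add_tsum_nat_add' (k := N)]
  refine ENNReal.add_lt_top.2 ⟨ENNReal.sum_lt_top.2 fun n _ =>
    ENNReal.mul_lt_top ENNReal.ofReal_lt_top (measure_lt_top _ _), ?_⟩
  have hterm : ∀ n : ℕ, K ^ (n + N) * (5 * Real.exp (-Real.log (2 * K) * ((n + N : ℕ) : ℝ))) =
      5 * (1 / 2) ^ N * (1 / 2) ^ n := by
    intro n
    rw [mul_comm (-Real.log (2 * K)), Real.exp_nat_mul, Real.exp_neg, Real.exp_log (by positivity),
      mul_left_comm, ← mul_pow, mul_assoc, ← pow_add, add_comm N n]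
    congr 2
    field_simp
  have hsum : Summable fun n : ℕ => 5 * (1 / 2 : ℝ) ^ N * (1 / 2) ^ n :=
    summable_geometric_two.mul_left _
  refine lt_of_le_of_lt (ENNReal.tsum_le_tsum fun n => ?_) hsum.tsum_ofReal_lt_top
  calc _ ≤ ENNReal.ofReal (K ^ (n + N)) *
        ENNReal.ofReal (5 * Real.exp (-Real.log (2 * K) * ((n + N : ℕ) : ℝ))) := by
        gcongr
        exact hN (n + N) (by omega)
    _ = _ := by rw [← ENNReal.ofReal_mul (by positivity), hterm]

/-! ### Affine bounds for concave utilities -/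

lemma IsConcaveUtility.real_concave {U : ℝ → EReal} (hU : IsConcaveUtility U) {y z a b p q r : ℝ}
    (hy : 0 < y) (hz : 0 < z) (ha : 0 < a) (hb : 0 < b) (hab : a + b = 1) (hp : U y = p)
    (hq : U z = q) (hr : U (a * y + b * z) = r) : a * p + b * q ≤ r := by
  have := hU.2 y z a b hy hz ha hb hab
  rw [hp, hq, hr] at this
  exact_mod_cast this

lemma IsConcaveUtility.exists_coe_eq {U : ℝ → EReal} (hU : IsConcaveUtility U) {y : ℝ}
    (hy : 0 < y) (h : U y ≠ ⊥) : ∃ c : ℝ, U y = c :=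
  ⟨(U y).toReal, (EReal.coe_toReal (hU.1 y hy) h).symm⟩

/-- Outside `[p, q]`, a concave utility lies below its chord over `[p, q]`. -/
lemma IsConcaveUtility.le_chord {U : ℝ → EReal} (hU : IsConcaveUtility U) {p q u v y : ℝ}
    (hp : 0 < p) (hpq : p < q) (hu : U p = u) (hv : U q = v) (hy : 0 < y) (h : y < p ∨ q < y) :
    U y ≤ ((u + (v - u) / (q - p) * (y - p) : ℝ) : EReal) := by
  by_cases hbot : U y = ⊥
  · rw [hbot]; exact bot_le
  obtain ⟨c, hc⟩ := hU.exists_coe_eq hy hbot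
  rw [hc, EReal.coe_le_coe_iff]
  have hd : 0 < q - p := by linarith
  rcases h with h | h
  · have hd' : 0 < q - y := by linarith
    have key := hU.real_concave (y := y) (z := q) (a := (q - p) / (q - y)) (b := (p - y) / (q - y))
      (p := c) (q := v) (r := u) hy (by linarith) (by positivity)
      (div_pos (by linarith) hd') (by field_simp; ring) hc hv
      (by rw [← hu]; congr 1; field_simp; ring)
    have e : (q - p) / (q - y) * c + (p - y) / (q - y) * v =
        ((q - p) * c + (p - y) * v) / (q - y) := by ring
    rw [e, div_le_iff₀ hd'] at key
    have e2 : u + (v - u) / (q - p) * (y - p) =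
        (u * (q - p) + (v - u) * (y - p)) / (q - p) := by field_simp
    rw [e2, le_div_iff₀ hd]
    linarith
  · have hd' : 0 < y - p := by linarith
    have key := hU.real_concave (y := p) (z := y) (a := (y - q) / (y - p)) (b := (q - p) / (y - p))
      (p := u) (q := c) (r := v) hp hy (div_pos (by linarith) hd') (by positivity)
      (by field_simp; ring) hu hc
      (by rw [← hv]; congr 1; field_simp; ring)
    have e : (y - q) / (y - p) * u + (q - p) / (y - p) * c =
        ((y - q) * u + (q - p) * c) / (y - p) := by ring
    rw [e, div_le_iff₀ hd'] at key
    have e2 : u + (v - u) / (q - p) * (y - p) =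
        (u * (q - p) + (v - u) * (y - p)) / (q - p) := by field_simp
    rw [e2, le_div_iff₀ hd]
    linarith

/-- A chord bounds `U` only outside its own interval, so two adjacent chords are used: the one over
`[m, q]` to the left of the midpoint `m`, the one over `[p, m]` to its right. Without two points of
finiteness a constant bounds `U`. -/
lemma IsConcaveUtility.exists_affine_bound_of_pos {U : ℝ → EReal} (hU : IsConcaveUtility U) :
    ∃ A C : ℝ, 0 ≤ A ∧ 0 < C ∧ ∀ y, 0 < y → U y ≤ ((A + C * y : ℝ) : EReal) := by
  by_cases h2 : ∃ p q : ℝ, 0 < p ∧ p < q ∧ U p ≠ ⊥ ∧ U q ≠ ⊥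
  · obtain ⟨p, q, hp, hpq, hup, huq⟩ := h2
    have hq : 0 < q := hp.trans hpq
    obtain ⟨u, hu⟩ := hU.exists_coe_eq hp hup
    obtain ⟨v, hv⟩ := hU.exists_coe_eq hq huq
    set m := 1 / 2 * p + 1 / 2 * q with hm
    have hpm : p < m := by linarith
    have hmq : m < q := by linarith
    have hm0 : 0 < m := hp.trans hpm
    have hum : U m ≠ ⊥ := by
      intro hbot
      have := hU.2 p q (1 / 2) (1 / 2) hp hq (by norm_num) (by norm_num) (by norm_num)
      rw [← hm, hbot, hu, hv, le_bot_iff, ← EReal.coe_mul, ← EReal.coe_mul, ← EReal.coe_add] at this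
      exact EReal.coe_ne_bot _ this
    obtain ⟨c, hc⟩ := hU.exists_coe_eq hm0 hum
    set D := |(c - u) / (m - p)| with hD
    set E := |(v - c) / (q - m)| with hE
    refine ⟨|u| + |c| + D * p + E * m, D + E + 1, by positivity, by positivity, fun y hy => ?_⟩
    have hDy : 0 ≤ D * y := by positivity
    have hEy : 0 ≤ E * y := by positivity
    have hDp : 0 ≤ D * p := by positivity
    have hEm : 0 ≤ E * m := by positivity
    have hc' := le_abs_self c
    have hu' := le_abs_self u
    have hslope : ∀ s z : ℝ, 0 < z → s * (y - z) ≤ |s| * y + |s| * z := by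
      intro s z hz
      have h1 := mul_le_mul_of_nonneg_right (le_abs_self s) hy.le
      have h2 := mul_le_mul_of_nonneg_right (neg_le_abs s) hz.le
      linarith
    rcases lt_trichotomy y m with h | h | h
    · refine (hU.le_chord hm0 hmq hc hv hy (Or.inl h)).trans (EReal.coe_le_coe_iff.2 ?_)
      have := hslope ((v - c) / (q - m)) m hm0
      linarith [abs_nonneg u]
    · rw [h, hc]
      refine EReal.coe_le_coe_iff.2 ?_
      rw [h] at hDy hEy
      linarith [abs_nonneg u]
    · refine (hU.le_chord hp hpm hu hc hy (Or.inr h)).trans (EReal.coe_le_coe_iff.2 ?_)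
      have := hslope ((c - u) / (m - p)) p hp
      linarith [abs_nonneg c]
  · push Not at h2
    by_cases h1 : ∃ p : ℝ, 0 < p ∧ U p ≠ ⊥
    · obtain ⟨p, hp, hup⟩ := h1
      obtain ⟨u, hu⟩ := hU.exists_coe_eq hp hup
      refine ⟨|u|, 1, abs_nonneg u, one_pos, fun y hy => ?_⟩
      by_cases hbot : U y = ⊥
      · rw [hbot]; exact bot_le
      rcases lt_trichotomy y p with h | h | h
      · exact absurd (h2 y p hy h hbot) hup
      · rw [h, hu]
        exact EReal.coe_le_coe_iff.2 (by linarith [le_abs_self u])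
      · exact absurd (h2 p y hp h hup) hbot
    · push Not at h1
      exact ⟨0, 1, le_rfl, one_pos, fun y hy => by rw [h1 y hy]; exact bot_le⟩

lemma IsConcaveUtility.exists_affine_bound {U : ℝ → EReal} (hU : IsConcaveUtility U) :
    ∃ A C : ℝ, 0 ≤ A ∧ 0 < C ∧ ∀ y, utilityOf U y ≤ ((A + C * |y| : ℝ) : EReal) := by
  obtain ⟨A, C, hA, hC, h⟩ := hU.exists_affine_bound_of_pos
  -- The extra `C` covers the right limit at `0`, estimated on `(0, 1)`.
  refine ⟨A + C, C, by linarith, hC, fun y => ?_⟩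
  unfold utilityOf
  split_ifs with hy
  · refine (h y hy).trans (EReal.coe_le_coe_iff.2 ?_)
    rw [abs_of_pos hy]
    linarith
  · refine Filter.limsup_le_of_le (h := ?_)
    filter_upwards [Ioo_mem_nhdsGT (one_pos (α := ℝ))] with z hz
    refine (h z hz.1).trans (EReal.coe_le_coe_iff.2 ?_)
    have h1 : C * z ≤ C := mul_le_of_le_one_right hC.le hz.2.le
    have h2 : 0 ≤ C * |y| := by positivity
    linarith

/-! ### The fractional Black-Scholes model -/

section Model

variable {Ω : Type*} {m : MeasurableSpace Ω} {P : Measure Ω} {T : ℝ≥0}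
  {𝓕 : Filtration (Iic T) m} {lam δ x : ℝ}

lemma log_fbsPrice (μ σ : ℝ) (B : Iic T → Ω → ℝ) (t : Iic T) (ω : Ω) :
    Real.log (fbsPrice μ σ B t ω) = μ * ((t : ℝ≥0) : ℝ) + σ * B t ω := Real.log_exp _

lemma ae_le_of_fluctuationCount_eq {H μ σ : ℝ} {B : Iic T → Ω → ℝ}
    (hB : IsFractionalBrownianMotion H B P) (hδ : 0 < δ)
    (hlam : (1 - lam) * Real.exp (2 * δ) < 1) {g : Ω → ℝ}
    (hg : g ∈ terminalWealths P 𝓕 (fbsPrice μ σ B) lam x) :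
    ∀ᵐ ω ∂P, ∀ n : ℕ, fluctuationCount δ (fun t => Real.log (fbsPrice μ σ B t ω)) = n →
      g ω ≤ x * growthFactor lam δ ^ n := by
  obtain ⟨φ0, φ1, hφ, hgφ⟩ := hg
  filter_upwards [hB.continuous_paths, hφ.cadlag_stock, hφ.selfFinancing, hφ.admissible, hgφ]
    with ω hω hcad hsf hadm hgω n hn
  rw [hgω]
  refine liquidationValue_le_of_fluctuationCount_eq (S := fun t => fbsPrice μ σ B t ω)
    ?_ (fun t => Real.exp_pos _) hδ hlam hcad hsf hadm hn
  unfold fbsPrice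
  fun_prop

lemma ae_nonneg_of_mem_terminalWealths {S : Iic T → Ω → ℝ} {g : Ω → ℝ}
    (hg : g ∈ terminalWealths P 𝓕 S lam x) : ∀ᵐ ω ∂P, 0 ≤ g ω := by
  obtain ⟨φ0, φ1, hφ, hgφ⟩ := hg
  filter_upwards [hφ.admissible, hgφ] with ω hadm hgω
  rw [hgω]
  exact hadm _

lemma const_mem_terminalWealths (S : Iic T → Ω → ℝ) (hx : 0 ≤ x) :
    (fun _ => x) ∈ terminalWealths P 𝓕 S lam x := by
  have hL : ∀ s, liquidationValue lam s x 0 = x := fun s => by simp [liquidationValue]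
  have hbv : ∀ a : ℝ, BoundedVariationOn (embedPath (T := T) a fun _ => a) univ := by
    intro a
    have h0 : embedPath (T := T) a (fun _ => a) = fun _ => a := by
      ext t; simp [embedPath]
    have h1 := eVariationOn.constant_on (f := fun _ : ℝ => a) (s := univ)
      (by simp [Set.Subsingleton])
    rw [h0, BoundedVariationOn, h1]
    exact ENNReal.zero_ne_top
  have hcad : ∀ a : ℝ, IsCadlagPath (T := T) fun _ => a := fun a =>
    ⟨fun _ => continuousWithinAt_const, fun _ => ⟨a, tendsto_const_nhds⟩⟩
  refine ⟨fun _ _ => x, fun _ _ => 0, ?_, ae_of_all _ fun ω => (hL _).symm⟩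
  exact
    { adapted_bond := fun _ => measurable_const
      adapted_stock := fun _ => measurable_const
      cadlag_bond := ae_of_all _ fun _ => hcad x
      cadlag_stock := ae_of_all _ fun _ => hcad 0
      finiteVariation_bond := ae_of_all _ fun _ => hbv x
      finiteVariation_stock := ae_of_all _ fun _ => hbv 0
      selfFinancing := ae_of_all _ fun _ => isSelfFinancingPath_const _ _ _
      admissible := ae_of_all _ fun ω t => by rw [hL]; exact hx }

lemma bot_lt_expectedUtility_const [IsProbabilityMeasure P] {U : ℝ → EReal} (hx : 0 < x)
    (htop : U x ≠ ⊤) (hbot : U x ≠ ⊥) : ⊥ < expectedUtility P U fun _ => x := by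
  have hU : utilityOf U x = U x := if_pos hx
  unfold expectedUtility expectedUtilityPos expectedUtilityNeg
  simp only [hU, lintegral_const, measure_univ, mul_one]
  lift U x to ℝ using ⟨htop, hbot⟩ with c
  rw [← EReal.coe_neg, EReal.toENNReal_of_ne_top (EReal.coe_ne_top _),
    EReal.toENNReal_of_ne_top (EReal.coe_ne_top _), EReal.toReal_coe, EReal.toReal_coe,
    EReal.coe_ennreal_ofReal, EReal.coe_ennreal_ofReal, ← EReal.coe_sub]
  exact EReal.bot_lt_coe _

/-- Measurable hulls keep the measures of the events `F ≥ n`, so measurability of the fluctuation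
count is never needed. -/
lemma lintegral_tsum_indicator {K : ℝ} (E : ℕ → Set Ω) :
    ∫⁻ ω, ∑' n : ℕ, (toMeasurable P (E n)).indicator (fun _ => ENNReal.ofReal (K ^ n)) ω ∂P =
      ∑' n : ℕ, ENNReal.ofReal (K ^ n) * P (E n) := by
  rw [lintegral_tsum fun n =>
    (measurable_const.indicator (measurableSet_toMeasurable P (E n))).aemeasurable]
  refine tsum_congr fun n => ?_
  rw [lintegral_indicator_const (measurableSet_toMeasurable P (E n)), measure_toMeasurable]

/-- If `F` counts something and `y ≤ x K ^ n` as soon as `F = n`, then `y` is bounded by `x` times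
the sum of the `K ^ n` over all `n ≤ F`. -/
lemma ofReal_le_tsum_of_count {K y : ℝ} (hK : 1 ≤ K) (hx : 0 < x) {F : ℕ∞}
    (h : ∀ n : ℕ, F = n → y ≤ x * K ^ n) {s : ℕ → ℝ≥0∞}
    (hs : ∀ n : ℕ, (n : ℕ∞) ≤ F → s n = ENNReal.ofReal (K ^ n)) :
    ENNReal.ofReal y ≤ ENNReal.ofReal x * ∑' n, s n := by
  induction F using ENat.recTopCoe with
  | top =>
    -- An infinite count needs no separate null-set argument, since then every term is at least `1`.
    have : ∑' n, s n = ⊤ := by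
      refine top_le_iff.1 ((ENNReal.tsum_const_eq_top_of_ne_zero (α := ℕ) one_ne_zero).symm.le.trans
        (ENNReal.tsum_le_tsum fun n => ?_))
      rw [hs n le_top, ← ENNReal.ofReal_one]
      exact ENNReal.ofReal_le_ofReal (one_le_pow₀ hK)
    rw [this, ENNReal.mul_top (ENNReal.ofReal_pos.2 hx).ne']
    exact le_top
  | coe n =>
    calc ENNReal.ofReal y ≤ ENNReal.ofReal (x * K ^ n) := ENNReal.ofReal_le_ofReal (h n rfl)
      _ = ENNReal.ofReal x * s n := by rw [ENNReal.ofReal_mul hx.le, hs n le_rfl]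
      _ ≤ _ := by gcongr; exact ENNReal.le_tsum n

/-- The bound is `A + C * x * ∑ K ^ n * P (F ≥ n)`: the affine bound on `U` combined with `K ^ F ≤
∑_{n ≤ F} K ^ n`. It does not depend on the strategy. -/
lemma exists_expectedUtilityPos_le [IsProbabilityMeasure P] {H μ σ : ℝ} {B : Iic T → Ω → ℝ}
    (hB : IsFractionalBrownianMotion H B P) (hH : 0 < H) (hT : 0 < T) (hσ : 0 < σ) (hδ : 0 < δ)
    (hlam : (1 - lam) * Real.exp (2 * δ) < 1) (hx : 0 < x) {U : ℝ → EReal}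
    (hU : IsConcaveUtility U) :
    ∃ R : ℝ≥0∞, R < ⊤ ∧ ∀ g ∈ terminalWealths P 𝓕 (fbsPrice μ σ B) lam x,
      expectedUtilityPos P U g ≤ R := by
  obtain ⟨A, C, hA, hC, hAC⟩ := hU.exists_affine_bound
  have hK := one_le_growthFactor hlam
  set K := growthFactor lam δ
  let E : ℕ → Set Ω := fun n =>
    {ω | (n : ℕ∞) ≤ fluctuationCount δ fun t => μ * ((t : ℝ≥0) : ℝ) + σ * B t ω}
  have hfin : ∑' n : ℕ, ENNReal.ofReal (K ^ n) * P (E n) < ⊤ :=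
    hB.tsum_pow_mul_measure_lt_top hH hT hσ hδ (by linarith)
  refine ⟨ENNReal.ofReal A + ENNReal.ofReal C * (ENNReal.ofReal x *
      ∑' n : ℕ, ENNReal.ofReal (K ^ n) * P (E n)), by finiteness, fun g hg => ?_⟩
  have hpt : ∀ᵐ ω ∂P, (utilityOf U (g ω)).toENNReal ≤ ENNReal.ofReal A + ENNReal.ofReal C *
      (ENNReal.ofReal x * ∑' n : ℕ,
        (toMeasurable P (E n)).indicator (fun _ => ENNReal.ofReal (K ^ n)) ω) := by
    filter_upwards [ae_le_of_fluctuationCount_eq hB hδ hlam hg,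
      ae_nonneg_of_mem_terminalWealths hg] with ω hω h0
    simp only [log_fbsPrice] at hω
    calc (utilityOf U (g ω)).toENNReal ≤ ((A + C * |g ω| : ℝ) : EReal).toENNReal :=
          EReal.toENNReal_le_toENNReal (hAC _)
      _ = ENNReal.ofReal A + ENNReal.ofReal C * ENNReal.ofReal (g ω) := by
          rw [EReal.toENNReal_of_ne_top (EReal.coe_ne_top _), EReal.toReal_coe, abs_of_nonneg h0,
            ENNReal.ofReal_add hA (by positivity), ENNReal.ofReal_mul hC.le]
      _ ≤ _ := by
          gcongr
          refine ofReal_le_tsum_of_count hK hx hω fun n hn => ?_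
          exact indicator_of_mem (subset_toMeasurable P (E n) hn) _
  refine (lintegral_mono_ae hpt).trans (le_of_eq ?_)
  rw [lintegral_add_left measurable_const, lintegral_const, measure_univ, mul_one,
    lintegral_const_mul' _ _ ENNReal.ofReal_ne_top, lintegral_const_mul' _ _ ENNReal.ofReal_ne_top,
    lintegral_tsum_indicator]

end Model

/-! ### Wealth bound and finiteness of the indirect utility -/

theorem mainTheorem7 (lam δ : ℝ) (hlam : 0 < lam) (hδ : 0 < δ)
    (hlamδ : (1 - lam) * Real.exp (2 * δ) < 1) :
    ∃ K : ℝ, 0 < K ∧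
      ∀ (Ω : Type*) (m : MeasurableSpace Ω) (P : Measure Ω) (_ : IsProbabilityMeasure P)
        (T : ℝ≥0) (_ : 0 < T) (𝓕 : Filtration (Iic T) m) (_ : UsualConditions 𝓕 P)
        (H μ σ : ℝ) (_ : 0 < H) (_ : H < 1) (_ : 0 < σ)
        (B : Iic T → Ω → ℝ) (_ : IsFractionalBrownianMotion H B P)
        (_ : Adapted 𝓕 (fbsPrice μ σ B)) (x : ℝ) (_ : 0 < x),
        (∀ g ∈ terminalWealths P 𝓕 (fbsPrice μ σ B) lam x,
          ∀ᵐ ω ∂P, ∀ n : ℕ,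
            fluctuationCount δ (fun t => Real.log (fbsPrice μ σ B t ω)) = n →
              g ω ≤ x * K ^ n) ∧
        ∀ U : ℝ → EReal, IsConcaveUtility U →
          (∃ M : ℝ, ∀ g ∈ terminalWealths P 𝓕 (fbsPrice μ σ B) lam x,
            expectedUtilityPos P U g < ⊤ ∧ expectedUtility P U g ≤ (M : EReal)) ∧
          indirectUtility P 𝓕 (fbsPrice μ σ B) lam U x < ⊤ ∧
          (U x ≠ ⊥ → ⊥ < indirectUtility P 𝓕 (fbsPrice μ σ B) lam U x) := by
  refine ⟨growthFactor lam δ, one_pos.trans_le (one_le_growthFactor hlamδ), ?_⟩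
  intro Ω m P _ T hT 𝓕 _ H μ σ hH _ hσ B hB _ x hx
  refine ⟨fun g hg => ae_le_of_fluctuationCount_eq hB hδ hlamδ hg, fun U hU => ?_⟩
  obtain ⟨R, hR, hbound⟩ := exists_expectedUtilityPos_le (𝓕 := 𝓕) (μ := μ) hB hH hT hσ hδ hlamδ hx hU
  lift R to ℝ≥0 using hR.ne
  have hle : ∀ g ∈ terminalWealths P 𝓕 (fbsPrice μ σ B) lam x,
      expectedUtility P U g ≤ ((R : ℝ) : EReal) := by
    intro g hg
    have h1 : (expectedUtilityPos P U g : EReal) ≤ ((R : ℝ≥0∞) : EReal) :=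
      EReal.coe_ennreal_le_coe_ennreal_iff.2 (hbound g hg)
    refine le_trans ?_ (h1.trans_eq (EReal.coe_nnreal_eq_coe_real R))
    rw [expectedUtility]
    exact EReal.sub_le_of_le_add (le_add_of_nonneg_right (EReal.coe_ennreal_nonneg _))
  refine ⟨⟨(R : ℝ), fun g hg => ⟨(hbound g hg).trans_lt hR, hle g hg⟩⟩, ?_, fun hUx => ?_⟩
  · exact (iSup₂_le hle).trans_lt (EReal.coe_lt_top _)
  · exact (bot_lt_expectedUtility_const hx (hU.1 x hx) hUx).trans_le
      (le_iSup₂ (f := fun g (_ : g ∈ terminalWealths P 𝓕 (fbsPrice μ σ B) lam x) =>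
        expectedUtility P U g) _ (const_mem_terminalWealths _ hx.le))
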